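/- A quantum adversary is a family of quantum circuits (with classical non-uniform advice) over a standard universal gate set, indexed by the security parameter $\lambda$; it has polynomial size if for all large $\lambda$ its number of gates and qubits is at most $p(\lambda)$ for some polynomial $p$. Vector commitments. A vector commitment $\mathsf{VC}=(\mathsf{Gen},\mathsf{Commit},\mathsf{Open},\mathsf{Verify})$ consists of a probabilistic $\mathsf{Gen}(1^\lambda,\Sigma,\ell)\to\mathsf{ck}$, a probabilistic $\mathsf{Commit}(\mathsf{ck},m)\to(\mathsf{cm},\mathsf{aux})$ for $m\in\Sigma^\ell$, and deterministic $\mathsf{Open}(\mathsf{ck},\mathsf{aux},Q)\to\mathsf{pf}$ and $\mathsf{Verify}(\mathsf{ck},\mathsf{cm},Q,v,\mathsf{pf})\in\{0,1\}$ for $Q\subseteq[\ell]$, $v\in\Sigma^Q$. It is collapsing if, for all alphabets $\Sigma=\Sigma_\lambda$, lengths $\ell=\ell_\lambda$ and polynomial-size quantum adversaries $\mathsf{Adv}$, the probabilities that the following experiment outputs $1$ for $b=0$ and for $b=1$ differ by a negligible function of $\lambda$: $\mathsf{ck}\gets\mathsf{Gen}(1^\lambda,\Sigma,\ell)$ is given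 to $\mathsf{Adv}$; $\mathsf{Adv}$ returns a classical message $(\mathsf{cm},Q)$ and a quantum state on registers $(\mathcal V,\mathcal O)$ holding strings $v\in\Sigma^Q$ and opening proofs $\mathsf{pf}$; the bit $\mathsf{Verify}(\mathsf{ck},\mathsf{cm},Q,\mathcal V,\mathcal O)$ is computed coherently, measured and uncomputed, and if it is $0$ the experiment aborts (with output $\bot\ne1$); if $b=1$, the registers $(\mathcal V,\mathcal O)$ are measured in the standard basis; they are returned to $\mathsf{Adv}$, whose output bit is the output of the experiment. Collapsing protocols. Consider an $m$-round protocol in which, in round $i$, the verifier $V$ sends a message $r_i$ drawn independently from a fixed distribution and the prover answers $z_i$; at the end $V$ decides on the transcript. The protocol is collapsing if, for all instances $x=x_\lambda$ with $|x_\lambda|\le\mathrm{poly}(\lambda)$, all polynomial-size interactive quantum provers $\tilde P$ (one unitary circuit per round, acting on the work register of $\tilde P$ and the two message registers of the round) and all polynomial-size quantum distinguishers $\mathsf{Adv}$, the probabilities that the following experiment outputs $1$ for $b=0$ and for $b=1$ differ by a negligible function of $\lambda$: run the interaction of $\tilde P$ and $V(1^\lambda,x)$ up to just before the measurement of the last response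 register $\mathcal Z_m$; coherently compute, measure and uncompute the decision bit of $V$ on the transcript completed by $\mathcal Z_m$, and abort if it is $0$; if $b=1$, measure $\mathcal Z_m$ in the standard basis and discard the result; give all registers to $\mathsf{Adv}$, whose output bit is the output of the experiment. Kilian's protocol. Let $\mathsf{PCP}=(\mathbf P,\mathbf V)$ be a PCP system for a relation $\mathfrak R$ with alphabet $\Sigma$, proof length $\ell$ and randomness complexity $\mathsf{rc}$ (depending on $\lambda$ and $|x|$), with perfect completeness, some soundness error, and a polynomial-time verifier (it suffices that the verifier has circuits of size $\mathrm{poly}(\lambda+|x|)$). The verifier is non-adaptive: on input $(1^\lambda,x)$ and randomness $r$ it reads the locations $Q=Q(\lambda,x,r)\subseteq[\ell]$ of the proof. In the two-round protocol $\mathsf{Kilian}[\mathsf{PCP},\mathsf{VC}]$, the verifier sends $\mathsf{ck}\gets\mathsf{Gen}(1^\lambda,\Sigma,\ell)$; the prover computes a PCP string $\pi\gets\mathbf P(x,w)$ and $(\mathsf{cm},\mathsf{aux})\gets\mathsf{Commit}(\mathsf{ck},\pi)$, and sends $\mathsf{cm}$; the verifier sends a uniformly random $r\in\{0,1\}^{\mathsf{rc}}$;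 the prover sends $(\pi[Q],\mathsf{pf})$ with $\mathsf{pf}=\mathsf{Open}(\mathsf{ck},\mathsf{aux},Q)$; the verifier accepts $(v,\mathsf{pf})$ if and only if $\mathbf V(1^\lambda,x;r)$ accepts the answers $v\in\Sigma^Q$ and $\mathsf{Verify}(\mathsf{ck},\mathsf{cm},Q,v,\mathsf{pf})=1$. Claim. If $\mathsf{VC}$ is a collapsing vector commitment, then for every such $\mathsf{PCP}$ the protocol $\mathsf{Kilian}[\mathsf{PCP},\mathsf{VC}]$ is collapsing. -/

import Mathlib

namespace PQ

/-! ### Asymptotics -/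

/-- `f` is eventually bounded by a polynomial in the security parameter. -/
def PolyBounded (f : ℕ → ℕ) : Prop :=
  ∃ p : Polynomial ℕ, ∃ lam₀ : ℕ, ∀ lam, lam₀ < lam → f lam ≤ p.eval lam

/-- `f` decreases faster than the inverse of any polynomial. -/
def Negligible (f : ℕ → ℝ) : Prop :=
  Asymptotics.SuperpolynomialDecay Filter.atTop (fun lam : ℕ => (lam : ℝ)) f

/-- Bit strings of length `n`. -/
abbrev BitStr (n : ℕ) := Fin n → Bool

/-! ### Boolean circuits -/

/-- A Boolean circuit with `n` input bits and `k` output bits, as a straight-line program over NAND.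
The wires are numbered: first the inputs, then the gates in order. A gate `(i, j)` computes the NAND
of the wires `i` and `j`; a wire that does not exist (yet) reads as the constant `false`. -/
structure BoolCircuit (n k : ℕ) where
  gates : List (ℕ × ℕ)
  outputs : Fin k → ℕ

/-- The values of all wires on input `x`. -/
def BoolCircuit.values {n k : ℕ} (C : BoolCircuit n k) (x : BitStr n) : List Bool :=
  C.gates.foldl (fun vs g => vs ++ [!(vs.getD g.1 false && vs.getD g.2 false)]) (List.ofFn x)

def BoolCircuit.eval {n k : ℕ} (C : BoolCircuit n k) (x : BitStr n) : BitStr k :=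
  fun j => (C.values x).getD (C.outputs j) false

def BoolCircuit.size {n k : ℕ} (C : BoolCircuit n k) : ℕ := n + C.gates.length + k

/-! ### Quantum circuits -/

/-- The universal gate set (Hadamard, `T`, NOT, CNOT, Toffoli), applied to qubits labelled by `W`. -/
inductive Gate (W : Type) : Type where
  | had (w : W) : Gate W
  | phaseT (w : W) : Gate W
  | not (w : W) : Gate W
  | cnot (c t : W) (h : c ≠ t) : Gate W
  | toffoli (c₁ c₂ t : W) (h₁₂ : c₁ ≠ c₂) (h₁ : c₁ ≠ t) (h₂ : c₂ ≠ t) : Gate W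

/-- A unitary quantum circuit on qubits labelled by `W`; the head of the list is applied first. -/
abbrev Circuit (W : Type) := List (Gate W)

/-- A (possibly sub-normalised) pure state of qubits labelled by `W`, by its amplitudes in the
computational basis. -/
abbrev QState (W : Type) := (W → Bool) → ℂ

section
variable {W : Type} [DecidableEq W]

/-- The unitary action of a gate. -/
noncomputable def Gate.apply : Gate W → QState W → QState W
  | .had w, ψ => fun b =>
      (ψ (Function.update b w false) +
        (if b w then -1 else 1) * ψ (Function.update b w true)) / (Real.sqrt 2 : ℂ)
  | .phaseT w, ψ => fun b =>
      (if b w then Complex.exp (Complex.I * (Real.pi / 4 : ℝ)) else 1) * ψ b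
  | .not w, ψ => fun b => ψ (Function.update b w (!(b w)))
  | .cnot c t _, ψ => fun b => ψ (Function.update b t (xor (b t) (b c)))
  | .toffoli c₁ c₂ t _ _ _, ψ => fun b => ψ (Function.update b t (xor (b t) (b c₁ && b c₂)))

noncomputable def Circuit.apply (C : Circuit W) (ψ : QState W) : QState W :=
  C.foldl (fun φ g => g.apply φ) ψ

end

/-- The computational basis state `b`. -/
noncomputable def ket {W : Type} (b : W → Bool) : QState W := Set.indicator {b} (fun _ => 1)

/-- Relabelling of the qubits: the gate acts on the subsystem `f : W ↪ W'`. -/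
def Gate.map {W W' : Type} (f : W ↪ W') : Gate W → Gate W'
  | .had w => .had (f w)
  | .phaseT w => .phaseT (f w)
  | .not w => .not (f w)
  | .cnot c t h => .cnot (f c) (f t) (f.injective.ne h)
  | .toffoli c₁ c₂ t h₁₂ h₁ h₂ =>
      .toffoli (f c₁) (f c₂) (f t) (f.injective.ne h₁₂) (f.injective.ne h₁) (f.injective.ne h₂)

def Circuit.mapWires {W W' : Type} (f : W ↪ W') (C : Circuit W) : Circuit W' :=
  List.map (Gate.map f) C

/-- The size of a quantum circuit: the number of its gates plus the number of its qubits. -/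
def Circuit.size {W : Type} [Fintype W] (C : Circuit W) : ℕ := List.length C + Fintype.card W

/-- The projector onto the span of the basis states in `S`. Applied to a state it yields the
unnormalised post-measurement state, whose squared norm is the probability of the outcome. -/
noncomputable def project {W : Type} (S : Set (W → Bool)) (ψ : QState W) : QState W :=
  S.indicator ψ

noncomputable def normSq {W : Type} [Fintype W] [DecidableEq W] (ψ : QState W) : ℝ :=
  ∑ b, ‖ψ b‖ ^ 2

/-- The basis states in which the register `reg` contains the string `s`. -/
def regEq {W : Type} {n : ℕ} (reg : Fin n → W) (s : BitStr n) : Set (W → Bool) :=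
  {b | ∀ j, b (reg j) = s j}

/-- The (unnormalised) probability that measuring the qubit `out` after running `C` on `ψ`
yields `1`. -/
noncomputable def outputProb {W : Type} [Fintype W] [DecidableEq W]
    (C : Circuit W) (out : W) (ψ : QState W) : ℝ :=
  normSq (project {b | b out = true} (C.apply ψ))

/-- The last part of both collapsing experiments: for `b = false` nothing is done to `ψ`, for
`b = true` the register `reg` is measured in the computational basis and the result is discarded;
then the distinguisher `C` gets all qubits, and the probability that it outputs `1` is returned. -/
noncomputable def challengeProb {W : Type} [Fintype W] [DecidableEq W] {n : ℕ}
    (b : Bool) (reg : Fin n → W) (C : Circuit W) (out : W) (ψ : QState W) : ℝ :=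
  if b then ∑ s : BitStr n, outputProb C out (project (regEq reg s) ψ) else outputProb C out ψ

/-! ### Alphabets and encodings -/

/-- A finite alphabet: a finite set of bit strings of a common length. -/
structure Alphabet where
  width : ℕ
  symbols : Finset (BitStr width)

abbrev Alphabet.Symbol (A : Alphabet) : Type := {a : BitStr A.width // a ∈ A.symbols}

/-- The number of bits of a location in `[ℓ]` (or of the blank `ℓ`, which is no location). -/
def indexLen (ℓ : ℕ) : ℕ := Nat.size ℓ

/-- The query set described by a list of `t` numbers in binary (little-endian): all those listed
numbers that are locations. -/
def decodeSet (ℓ t : ℕ) (a : BitStr (t * indexLen ℓ)) : Finset (Fin ℓ) :=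
  Finset.univ.filter fun i =>
    ∃ j : Fin t, ∀ b : Fin (indexLen ℓ), a (finProdFinEquiv (j, b)) = Nat.testBit i b

/-- The encoding of `v ∈ Σ^Q` (with `|Q| ≤ t`) in `t` slots of one symbol each: the symbols in
increasing order of their locations, then zeros. -/
def encodeAnswers {A : Alphabet} {ℓ : ℕ} (t : ℕ) (Q : Finset (Fin ℓ)) (v : Q → A.Symbol) :
    BitStr (t * A.width) :=
  fun k =>
    if h : (finProdFinEquiv.symm k).1.val < Q.card then
      (v (Q.orderIsoOfFin rfl ⟨(finProdFinEquiv.symm k).1.val, h⟩)).1 (finProdFinEquiv.symm k).2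
    else false

/-- Padding of a bit string with zeros. -/
def padTo {n : ℕ} (N : ℕ) (s : BitStr n) : BitStr N :=
  fun j => if h : j.val < n then s ⟨j.val, h⟩ else false

/-! ### Vector commitments -/

/-- A (static) vector commitment scheme. All algorithms depend on the security parameter, the
alphabet `Σ` and the vector length `ℓ`. The opening proofs for a query set `Q` are bit strings of
length `proofLen Q`. -/
structure VectorCommitment where
  keyLen : ℕ → Alphabet → ℕ → ℕ
  comLen : ℕ → Alphabet → ℕ → ℕ
  proofLen : ∀ (_lam : ℕ) (_A : Alphabet) (ℓ : ℕ), Finset (Fin ℓ) → ℕ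
  /-- `Gen(1^λ, Σ, ℓ)`: a distribution on commitment keys. -/
  gen : ∀ (lam : ℕ) (A : Alphabet) (ℓ : ℕ), PMF (BitStr (keyLen lam A ℓ))
  /-- `Commit(ck, m)`: a distribution on commitments and auxiliary information. -/
  commit : ∀ (lam : ℕ) (A : Alphabet) (ℓ : ℕ), BitStr (keyLen lam A ℓ) → (Fin ℓ → A.Symbol) →
    PMF (BitStr (comLen lam A ℓ) × List Bool)
  /-- `Open(ck, aux, Q)`. -/
  openAt : ∀ (lam : ℕ) (A : Alphabet) (ℓ : ℕ), BitStr (keyLen lam A ℓ) → List Bool →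
    (Q : Finset (Fin ℓ)) → BitStr (proofLen lam A ℓ Q)
  /-- `Verify(ck, cm, Q, v, pf)`. -/
  verify : ∀ (lam : ℕ) (A : Alphabet) (ℓ : ℕ), BitStr (keyLen lam A ℓ) → BitStr (comLen lam A ℓ) →
    (Q : Finset (Fin ℓ)) → (Q → A.Symbol) → BitStr (proofLen lam A ℓ Q) → Bool

namespace VectorCommitment

variable (VC : VectorCommitment) (lam : ℕ) (A : Alphabet) (ℓ : ℕ)

/-- The length of a register that holds opening proofs for query sets of size at most `t`. -/
def maxProofLen (t : ℕ) : ℕ :=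
  (Finset.univ.filter fun Q : Finset (Fin ℓ) => Q.card ≤ t).sup (VC.proofLen lam A ℓ)

/-- The length of the registers `(𝒱, 𝒪)` for query sets of size at most `t`. -/
abbrev openingLen (t : ℕ) : ℕ := t * A.width + VC.maxProofLen lam A ℓ t

/-- The content of the registers `(𝒱, 𝒪)` that represents `(v, pf)`. -/
def encodeOpening (t : ℕ) (Q : Finset (Fin ℓ)) (v : Q → A.Symbol)
    (pf : BitStr (VC.proofLen lam A ℓ Q)) : BitStr (VC.openingLen lam A ℓ t) :=
  Fin.append (encodeAnswers t Q v) (padTo (VC.maxProofLen lam A ℓ t) pf)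

/-- The qubits of an adversary: its work space, the commitment key `ck`, the message `(cm, Q)`, and
the registers `(𝒱, 𝒪)`. -/
abbrev AdvWire (work t : ℕ) : Type :=
  Fin work ⊕ (Fin (VC.keyLen lam A ℓ) ⊕
    ((Fin (VC.comLen lam A ℓ) ⊕ Fin (t * indexLen ℓ)) ⊕ Fin (VC.openingLen lam A ℓ t)))

/-- A quantum adversary against the collapsing property: `stage₁` is run on `ck` and produces
`(cm, Q)` and the state on `(𝒱, 𝒪)`, `stage₂` is run after the registers `(𝒱, 𝒪)` have been
returned, and `out` is the qubit whose measurement is the output. The adversary chooses the bound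
`t` on the number of opened locations. -/
structure Adversary where
  work : ℕ
  t : ℕ
  stage₁ : Circuit (VC.AdvWire lam A ℓ work t)
  stage₂ : Circuit (VC.AdvWire lam A ℓ work t)
  out : VC.AdvWire lam A ℓ work t

variable {VC lam A ℓ}

namespace Adversary

def size (Adv : VC.Adversary lam A ℓ) : ℕ := Circuit.size Adv.stage₁ + Circuit.size Adv.stage₂

variable (Adv : VC.Adversary lam A ℓ)

abbrev Wire : Type := VC.AdvWire lam A ℓ Adv.work Adv.t

def comReg : Fin (VC.comLen lam A ℓ) → Adv.Wire := fun j => .inr (.inr (.inl (.inl j)))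

def setReg : Fin (Adv.t * indexLen ℓ) → Adv.Wire := fun j => .inr (.inr (.inl (.inr j)))

def openReg : Fin (VC.openingLen lam A ℓ Adv.t) → Adv.Wire := fun j => .inr (.inr (.inr j))

/-- Initially the key register contains `ck` and all other qubits are `0`. -/
def initial (ck : BitStr (VC.keyLen lam A ℓ)) : Adv.Wire → Bool
  | .inr (.inl j) => ck j
  | _ => false

/-- The basis states whose registers `(𝒱, 𝒪)` contain a pair `(v, pf)` that verifies. Computing the
bit `Verify(ck, cm, Q, 𝒱, 𝒪)` into an ancilla, measuring it and uncomputing is the projective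
measurement onto the span of these states and its complement. -/
def acceptSet (ck : BitStr (VC.keyLen lam A ℓ)) (cm : BitStr (VC.comLen lam A ℓ))
    (Q : Finset (Fin ℓ)) : Set (Adv.Wire → Bool) :=
  {b | ∃ v pf, (fun j => b (Adv.openReg j)) = VC.encodeOpening lam A ℓ Adv.t Q v pf ∧
    VC.verify lam A ℓ ck cm Q v pf = true}

/-- The probability that the collapsing experiment with bit `b` outputs `1`: the key `ck` is
sampled, `stage₁` is run, the message `(cm, Q)` is measured, the experiment goes on if verification
succeeds, and `(𝒱, 𝒪)` is measured if `b = true`. -/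
noncomputable def expProb (b : Bool) : ℝ :=
  ∑ ck : BitStr (VC.keyLen lam A ℓ), (VC.gen lam A ℓ ck).toReal *
    ∑ cm : BitStr (VC.comLen lam A ℓ), ∑ q : BitStr (Adv.t * indexLen ℓ),
      challengeProb b Adv.openReg Adv.stage₂ Adv.out
        (project (Adv.acceptSet ck cm (decodeSet ℓ Adv.t q))
          (project (regEq Adv.comReg cm ∩ regEq Adv.setReg q)
            (Circuit.apply Adv.stage₁ (ket (Adv.initial ck)))))

end Adversary

/-- `VC` is collapsing: for all alphabets `Σ_λ`, vector lengths `ℓ_λ`, and polynomial-size quantum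
adversaries, the two experiments are indistinguishable. -/
def IsCollapsing (VC : VectorCommitment) : Prop :=
  ∀ (A : ℕ → Alphabet) (ℓ : ℕ → ℕ) (Adv : ∀ lam, VC.Adversary lam (A lam) (ℓ lam)),
    PolyBounded (fun lam => (Adv lam).size) →
      Negligible fun lam => |(Adv lam).expProb false - (Adv lam).expProb true|

end VectorCommitment

/-! ### Public-coin interactive protocols -/

/-- A protocol `(P, V)` with `last + 1` rounds, each consisting of a verifier message followed by a
prover message. The message of the verifier in round `i` is drawn from the distribution
`chal lam x i` independently of everything else. The inputs are the security parameter, the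
instance `x` and, for `P`, a witness. -/
structure Protocol where
  last : ℕ
  chalLen : ℕ → List Bool → Fin (last + 1) → ℕ
  respLen : ℕ → List Bool → Fin (last + 1) → ℕ
  chal : ∀ (lam : ℕ) (x : List Bool) (i : Fin (last + 1)), PMF (BitStr (chalLen lam x i))
  /-- The states of the honest prover. -/
  ProverState : ℕ → List Bool → Type
  /-- The state of the honest prover with witness `w` at the beginning. -/
  proverInit : ∀ (lam : ℕ) (x _w : List Bool), ProverState lam x
  /-- The move of the honest prover in round `i`. -/
  proverStep : ∀ (lam : ℕ) (x : List Bool) (i : Fin (last + 1)), ProverState lam x →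
    BitStr (chalLen lam x i) → PMF (ProverState lam x × BitStr (respLen lam x i))
  /-- The decision of the verifier on the transcript `(r₁, z₁, …, r_m, z_m)`. -/
  accepts : ∀ (lam : ℕ) (x : List Bool), (∀ i, BitStr (chalLen lam x i)) →
    (∀ i, BitStr (respLen lam x i)) → Prop

/-- An interactive quantum circuit for `m` rounds with message lengths `k i` and `z i`: one unitary
circuit `U i` for each round, which acts on the work register and the two message registers of
that round. -/
structure QProver {m : ℕ} (k z : Fin m → ℕ) where
  work : ℕ
  U : ∀ i : Fin m, Circuit (Fin work ⊕ (Fin (k i) ⊕ Fin (z i)))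

namespace QProver

variable {m : ℕ} {k z : Fin m → ℕ}

def size (P : QProver k z) : ℕ := ∑ i, Circuit.size (P.U i)

/-- All qubits of the experiment: the work register of the prover, its registers for the messages
of all rounds, and `anc` qubits of the distinguisher. -/
abbrev Wire (P : QProver k z) (anc : ℕ) : Type :=
  Fin P.work ⊕ ((Σ i : Fin m, Fin (k i)) ⊕ ((Σ i : Fin m, Fin (z i)) ⊕ Fin anc))

/-- The qubits on which the circuit of round `i` acts. -/
def roundEmb (P : QProver k z) (anc : ℕ) (i : Fin m) :
    (Fin P.work ⊕ (Fin (k i) ⊕ Fin (z i))) ↪ P.Wire anc :=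
  Function.Embedding.sumMap (Function.Embedding.refl _)
    (Function.Embedding.sumMap (Function.Embedding.sigmaMk (β := fun i => Fin (k i)) i)
      ((Function.Embedding.sigmaMk (β := fun i => Fin (z i)) i).trans Function.Embedding.inl))

/-- The response register of round `i`. -/
def respReg (P : QProver k z) (anc : ℕ) (i : Fin m) : Fin (z i) → P.Wire anc :=
  fun j => .inr (.inr (.inl ⟨i, j⟩))

/-- The initial basis state. The challenge registers contain the messages `r` of the verifier from
the beginning; as the register of round `i` is not accessed before round `i`, this is the same as
initialising it in that round. -/
def initial (P : QProver k z) (anc : ℕ) (r : ∀ i, BitStr (k i)) : P.Wire anc → Bool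
  | .inr (.inl ⟨i, j⟩) => r i j
  | _ => false

/-- The application of the circuit of round `i`. -/
noncomputable def step (P : QProver k z) (anc : ℕ) (i : Fin m) (ψ : QState (P.Wire anc)) :
    QState (P.Wire anc) :=
  Circuit.apply (Circuit.mapWires (P.roundEmb anc i) (P.U i)) ψ

end QProver

/-- A quantum distinguisher, which gets all registers of the prover, has `anc` further qubits, and
outputs the measurement of the qubit `out`. -/
structure Distinguisher {m : ℕ} {k z : Fin m → ℕ} (P : QProver k z) where
  anc : ℕ
  circuit : Circuit (P.Wire anc)
  out : P.Wire anc

def Distinguisher.size {m : ℕ} {k z : Fin m → ℕ} {P : QProver k z} (D : Distinguisher P) : ℕ :=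
  Circuit.size D.circuit

/-- The (unnormalised) state after the first `j` rounds with messages `r` of the verifier, on the
branch where the measured responses of the prover are given by `s`. -/
noncomputable def QProver.stateAfter {m : ℕ} {k z : Fin (m + 1) → ℕ} (P : QProver k z) (anc : ℕ)
    (r : ∀ i, BitStr (k i)) (s : ∀ i : Fin m, BitStr (z i.castSucc)) :
    (j : ℕ) → j ≤ m → QState (P.Wire anc)
  | 0, _ => ket (P.initial anc r)
  | j + 1, h =>
      project (regEq (P.respReg anc (Fin.castSucc ⟨j, h⟩)) (s ⟨j, h⟩))
        (P.step anc (Fin.castSucc ⟨j, h⟩) (P.stateAfter anc r s j (Nat.le_of_succ_le h)))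

namespace Protocol

variable (Pr : Protocol) (lam : ℕ) (x : List Bool)

/-- The basis states on whose last response register the verifier accepts, given the rest of the
transcript. Computing the decision into an ancilla, measuring it and uncomputing is the projective
measurement onto the span of these states and its complement. -/
def acceptSet {k z : Fin (Pr.last + 1) → ℕ} (P : QProver k z) (anc : ℕ)
    (acc : (∀ i, BitStr (z i)) → Prop) (s : ∀ i : Fin Pr.last, BitStr (z i.castSucc)) :
    Set (P.Wire anc → Bool) :=
  {b | acc (Fin.snoc (α := fun i => BitStr (z i)) s
    (fun j => b (P.respReg anc (Fin.last Pr.last) j)))}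

/-- The probability that the collapsing experiment with bit `b` outputs `1`: the interaction is run
up to the last response, whose register is not measured; the experiment goes on if the verifier
accepts; the last response register is measured if `b = true`; then all registers are given to the
distinguisher. -/
noncomputable def collapseProb (b : Bool)
    (P : QProver (Pr.chalLen lam x) (Pr.respLen lam x)) (D : Distinguisher P) : ℝ :=
  ∑ r : (∀ i, BitStr (Pr.chalLen lam x i)), (∏ i, (Pr.chal lam x i (r i)).toReal) *
    ∑ s : (∀ i : Fin Pr.last, BitStr (Pr.respLen lam x i.castSucc)),
      challengeProb b (P.respReg D.anc (Fin.last Pr.last)) D.circuit D.out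
        (project (Pr.acceptSet P D.anc (Pr.accepts lam x r) s)
          (P.step D.anc (Fin.last Pr.last) (P.stateAfter D.anc r s Pr.last le_rfl)))

/-- The protocol is collapsing: for all instances `x_λ` of polynomial size, all polynomial-size
interactive quantum provers and all polynomial-size quantum distinguishers, the two experiments are
indistinguishable. -/
def IsCollapsing (Pr : Protocol) : Prop :=
  ∀ x : ℕ → List Bool, PolyBounded (fun lam => (x lam).length) →
    ∀ (P : ∀ lam, QProver (Pr.chalLen lam (x lam)) (Pr.respLen lam (x lam)))
      (D : ∀ lam, Distinguisher (P lam)),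
      PolyBounded (fun lam => (P lam).size) → PolyBounded (fun lam => (D lam).size) →
        Negligible fun lam =>
          |Pr.collapseProb lam (x lam) false (P lam) (D lam) -
            Pr.collapseProb lam (x lam) true (P lam) (D lam)|

end Protocol

/-! ### Probabilistically checkable proofs -/

/-- The prover and the (non-adaptive) verifier of a PCP. The alphabet, the proof length, the
randomness complexity and the query complexity may depend on the security parameter and on the
size of the instance. On the random string `r`, the verifier reads the locations `query lam x r` of
the proof and decides by `decide lam x r`. -/
structure PCP where
  alphabet : ℕ → ℕ → Alphabet
  proofLen : ℕ → ℕ → ℕ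
  randLen : ℕ → ℕ → ℕ
  queryLen : ℕ → ℕ → ℕ
  prove : ∀ (lam : ℕ) (x _w : List Bool),
    PMF (Fin (proofLen lam x.length) → (alphabet lam x.length).Symbol)
  query : ∀ (lam : ℕ) (x : List Bool),
    BitStr (randLen lam x.length) → Finset (Fin (proofLen lam x.length))
  decide : ∀ (lam : ℕ) (x : List Bool) (r : BitStr (randLen lam x.length)),
    (query lam x r → (alphabet lam x.length).Symbol) → Bool
  card_query_le : ∀ lam x r, (query lam x r).card ≤ queryLen lam x.length

namespace PCP

variable (S : PCP)

/-- The probability, over its random string, that the verifier accepts the proof `π`. -/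
noncomputable def acceptProb (lam : ℕ) (x : List Bool)
    (π : Fin (S.proofLen lam x.length) → (S.alphabet lam x.length).Symbol) : ℝ :=
  ((Finset.univ.filter fun r : BitStr (S.randLen lam x.length) =>
    S.decide lam x r (fun i => π i) = true).card : ℝ) / 2 ^ S.randLen lam x.length

/-- The verifier on instance `x` is computed by circuits of size polynomial in `λ + |x|`, as is the
case for every polynomial-time verifier: one circuit maps `r` to its queries, and one circuit maps
`r` and the answers to the decision (and rejects strings that encode no answers). -/
def EfficientVerifier : Prop :=
  ∃ p : Polynomial ℕ, ∀ (lam : ℕ) (x : List Bool),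
    (∃ C : BoolCircuit (S.randLen lam x.length)
        (S.queryLen lam x.length * indexLen (S.proofLen lam x.length)),
      C.size ≤ p.eval (lam + x.length) ∧ ∀ r, decodeSet _ _ (C.eval r) = S.query lam x r) ∧
    (∃ C : BoolCircuit (S.randLen lam x.length +
        S.queryLen lam x.length * (S.alphabet lam x.length).width) 1,
      C.size ≤ p.eval (lam + x.length) ∧ ∀ r a, C.eval (Fin.append r a) 0 = true ↔
        ∃ v, a = encodeAnswers (S.queryLen lam x.length) (S.query lam x r) v ∧
          S.decide lam x r v = true)

/-- `S` is a PCP system for the relation `R` with soundness error `ε`. -/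
structure IsPCPFor (R : Set (List Bool × List Bool)) (ε : ℕ → ℕ → ℝ) : Prop where
  efficient : S.EfficientVerifier
  complete : ∀ (lam : ℕ) (x w : List Bool), (x, w) ∈ R →
    ∀ π ∈ (S.prove lam x w).support, S.acceptProb lam x π = 1
  sound : ∀ (lam : ℕ) (x : List Bool), (¬ ∃ w, (x, w) ∈ R) →
    ∀ π, S.acceptProb lam x π ≤ ε lam x.length

end PCP

/-! ### Kilian's protocol -/

section

variable (S : PCP) (VC : VectorCommitment)

/-- The commitment key length for proofs of the PCP. -/
abbrev kilianKeyLen (lam : ℕ) (x : List Bool) : ℕ :=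
  VC.keyLen lam (S.alphabet lam x.length) (S.proofLen lam x.length)

abbrev kilianComLen (lam : ℕ) (x : List Bool) : ℕ :=
  VC.comLen lam (S.alphabet lam x.length) (S.proofLen lam x.length)

/-- The length of the second prover message `(π[Q], pf)`. -/
abbrev kilianOpenLen (lam : ℕ) (x : List Bool) : ℕ :=
  VC.openingLen lam (S.alphabet lam x.length) (S.proofLen lam x.length) (S.queryLen lam x.length)

/-- The final check of the verifier on `(ck, cm, r, z)`, where `z` has to encode a pair `(v, pf)`. -/
def kilianAccepts (lam : ℕ) (x : List Bool) (ck : BitStr (kilianKeyLen S VC lam x))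
    (cm : BitStr (kilianComLen S VC lam x)) (r : BitStr (S.randLen lam x.length))
    (z : BitStr (kilianOpenLen S VC lam x)) : Prop :=
  ∃ v pf, z = VC.encodeOpening lam (S.alphabet lam x.length) (S.proofLen lam x.length)
      (S.queryLen lam x.length) (S.query lam x r) v pf ∧
    S.decide lam x r v = true ∧
    VC.verify lam (S.alphabet lam x.length) (S.proofLen lam x.length) ck cm (S.query lam x r) v pf
      = true

/-- The states of the honest prover: the witness, and after the first round `(ck, π, aux)`. -/
abbrev KilianState (lam : ℕ) (x : List Bool) : Type :=
  List Bool ⊕ (BitStr (kilianKeyLen S VC lam x) ×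
    (Fin (S.proofLen lam x.length) → (S.alphabet lam x.length).Symbol) × List Bool)

/-- Round one of the honest prover: compute the PCP string and commit to it. -/
noncomputable def kilianCommit (lam : ℕ) (x : List Bool) (σ : KilianState S VC lam x)
    (ck : BitStr (kilianKeyLen S VC lam x)) :
    PMF (KilianState S VC lam x × BitStr (kilianComLen S VC lam x)) :=
  match σ with
  | .inl w =>
      (S.prove lam x w).bind fun π =>
        (VC.commit lam (S.alphabet lam x.length) (S.proofLen lam x.length) ck π).map fun c =>
          (.inr (ck, π, c.2), c.1)
  | .inr σ => PMF.pure (.inr σ, fun _ => false)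

/-- Round two of the honest prover: open the commitment at the queried locations. -/
noncomputable def kilianOpen (lam : ℕ) (x : List Bool) (σ : KilianState S VC lam x)
    (r : BitStr (S.randLen lam x.length)) :
    PMF (KilianState S VC lam x × BitStr (kilianOpenLen S VC lam x)) :=
  match σ with
  | .inl w => PMF.pure (.inl w, fun _ => false)
  | .inr (ck, π, aux) =>
      PMF.pure (.inr (ck, π, aux),
        VC.encodeOpening lam (S.alphabet lam x.length) (S.proofLen lam x.length)
          (S.queryLen lam x.length) (S.query lam x r) (fun i => π i)
          (VC.openAt lam (S.alphabet lam x.length) (S.proofLen lam x.length) ck aux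
            (S.query lam x r)))

/-- Kilian's protocol for the PCP `S` and the vector commitment `VC`. In the first round the
verifier sends `ck ← Gen` and receives `cm`; in the second round it sends a uniformly random `r`
and receives `(π[Q], pf)`. -/
noncomputable def kilian : Protocol where
  last := 1
  chalLen lam x
    | 0 => kilianKeyLen S VC lam x
    | 1 => S.randLen lam x.length
  respLen lam x
    | 0 => kilianComLen S VC lam x
    | 1 => kilianOpenLen S VC lam x
  chal lam x
    | 0 => VC.gen lam (S.alphabet lam x.length) (S.proofLen lam x.length)
    | 1 => PMF.uniformOfFintype (BitStr (S.randLen lam x.length))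
  ProverState lam x := KilianState S VC lam x
  proverInit _ _ w := .inl w
  proverStep lam x
    | 0 => kilianCommit S VC lam x
    | 1 => kilianOpen S VC lam x
  accepts lam x r z := kilianAccepts S VC lam x (r 0) (z 0) (r 1) (z 1)

end

end PQ

/-! The second verifier message `r` consists of public coins, so an adversary against the vector
commitment can produce it itself: given `ck`, it runs both rounds of the prover on its own coins and
submits the commitment, the query set of `r` and the unmeasured last response. The challenger of the
vector commitment then measures, or does not measure, exactly the register that the Kilian
experiment treats in this way. The reduction is exact: for each `b` the two experiments output 1
with equal probability (`expProb_kilianAdversary`), and the adversary is only a constant factor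
larger than its ingredients (`size_kilianAdversary`).

Exactness rests on four points.

The coins are a uniform superposition made by Hadamard gates. A private copy of `r` stays in a coin
register that no later gate modifies, so branches with different `r` remain orthogonal and their
probabilities add with weight `2^(-m)` (`CoinReduction.outputProb_stage₂`). It does no harm that
several `r` may lead to the same measured query string.

The vector commitment experiment measures `cm` after the second round instead of before it. The
second round does not touch the first response register, so the two orders agree
(`QProver.step_one_project`).

The vector commitment experiment aborts only if the opening fails, not if the PCP verifier rejects.
The adversary therefore computes the PCP decision into a flag and finally takes the conjunction of
the flag with the output of the distinguisher, so a rejecting branch never outputs 1. Scratch qubits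
are uncomputed (`BoolCircuit.apply_toCircuit`); otherwise intermediate values would stay entangled
with the answers and act as an additional measurement of them.

Acceptance in Kilian's protocol is a condition on a single `v`, whereas the reduction tests decision
and opening separately. Injectivity of the encoding of answers makes both tests speak of the same
`v` (`ComputeVerifier.accepts_iff`). -/

namespace PQ

/-! ### Classical gates -/

section Classical

set_option linter.unusedSectionVars false

variable {W : Type} [DecidableEq W]

/-- The gate permutes the computational basis. -/
def Gate.IsClassical : Gate W → Prop
  | .had _ => False
  | .phaseT _ => False
  | _ => True

/-- The action of a classical gate on basis states. -/
def Gate.act : Gate W → (W → Bool) → (W → Bool)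
  | .not w, b => Function.update b w (!(b w))
  | .cnot c t _, b => Function.update b t (xor (b t) (b c))
  | .toffoli c₁ c₂ t _ _ _, b => Function.update b t (xor (b t) (b c₁ && b c₂))
  | _, b => b

theorem Gate.act_act (g : Gate W) (b : W → Bool) : g.act (g.act b) = b := by
  cases g with
  | had w => rfl
  | phaseT w => rfl
  | not w => simp [Gate.act]
  | cnot c t h => simp [Gate.act, h]
  | toffoli c₁ c₂ t h₁₂ h₁ h₂ => simp [Gate.act, h₁, h₂]

theorem Gate.apply_eq_act {g : Gate W} (hg : g.IsClassical) (ψ : QState W) (b : W → Bool) :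
    g.apply ψ b = ψ (g.act b) := by
  cases g <;> first | exact hg.elim | rfl

/-- The basis state reached from `b` by the classical circuit `C`. -/
def Circuit.run (C : Circuit W) (b : W → Bool) : W → Bool := C.foldl (fun b g => g.act b) b

/-- The basis state from which the classical circuit `C` reaches `b`. -/
def Circuit.pull (C : Circuit W) (b : W → Bool) : W → Bool := C.foldr Gate.act b

theorem Circuit.apply_append (C C' : Circuit W) (ψ : QState W) :
    Circuit.apply (C ++ C') ψ = Circuit.apply C' (Circuit.apply C ψ) :=
  List.foldl_append

theorem Circuit.apply_cons (g : Gate W) (C : Circuit W) (ψ : QState W) :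
    Circuit.apply (g :: C) ψ = Circuit.apply C (g.apply ψ) := rfl

/-- Every classical gate is its own inverse, so it moves amplitudes by precomposition with its
action. The last gate of the list is then evaluated first on `b`, hence a right fold. -/
theorem Circuit.apply_eq_pull (C : Circuit W) (hC : ∀ g ∈ C, g.IsClassical) (ψ : QState W)
    (b : W → Bool) : C.apply ψ b = ψ (Circuit.pull C b) := by
  induction C generalizing ψ with
  | nil => rfl
  | cons g C ih =>
    rw [Circuit.apply_cons, ih (fun g' h => hC g' (List.mem_cons_of_mem _ h)),
      Gate.apply_eq_act (hC g List.mem_cons_self)]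
    rfl

theorem Circuit.pull_append (C C' : Circuit W) (b : W → Bool) :
    Circuit.pull (C ++ C') b = Circuit.pull C (Circuit.pull C' b) :=
  List.foldr_append

theorem Circuit.pull_reverse (C : Circuit W) (b : W → Bool) :
    Circuit.pull C.reverse b = Circuit.run C b := by
  simp [Circuit.pull, Circuit.run]

theorem Circuit.pull_run (C : Circuit W) (b : W → Bool) :
    Circuit.pull C (Circuit.run C b) = b := by
  induction C generalizing b with
  | nil => rfl
  | cons g C ih =>
    change g.act (Circuit.pull C (Circuit.run C (g.act b))) = b
    rw [ih, Gate.act_act]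

theorem Circuit.run_pull (C : Circuit W) (b : W → Bool) :
    Circuit.run C (Circuit.pull C b) = b := by
  induction C generalizing b with
  | nil => rfl
  | cons g C ih =>
    change Circuit.run C (g.act (g.act (Circuit.pull C b))) = b
    rw [Gate.act_act, ih]

theorem Circuit.run_append (C C' : Circuit W) (b : W → Bool) :
    Circuit.run (C ++ C') b = Circuit.run C' (Circuit.run C b) :=
  List.foldl_append

/-! ### Clean evaluation of Boolean circuits -/

/-- Computes into `t` (which must be `0`) the NAND of two optional wires; a missing wire reads as
`false`. -/
def nandGates (a c : Option W) (t : W) : Circuit W :=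
  Gate.not t :: match a, c with
    | some a, some c =>
        if h : a ≠ t ∧ c ≠ t then
          -- A Toffoli gate needs distinct controls. If both inputs are the same wire, their
          -- conjunction is that wire and a CNOT suffices.
          if h' : a ≠ c then [Gate.toffoli a c t h' h.1 h.2] else [Gate.cnot a t h.1]
        else []
    | _, _ => []

theorem length_nandGates (a c : Option W) (t : W) : (nandGates a c t).length ≤ 2 := by
  unfold nandGates
  split
  · split_ifs <;> simp
  · simp

theorem isClassical_of_mem_nandGates (a c : Option W) (t : W) :
    ∀ g ∈ nandGates a c t, g.IsClassical := by
  unfold nandGates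
  split
  · split_ifs <;> simp [Gate.IsClassical]
  · simp [Gate.IsClassical]

/-- The value of an optional wire. -/
def readWire (b : W → Bool) (a : Option W) : Bool := (a.map b).getD false

theorem run_nandGates (a c : Option W) (t : W) (ha : a ≠ some t) (hc : c ≠ some t) (b : W → Bool)
    (ht : b t = false) :
    Circuit.run (nandGates a c t) b =
      Function.update b t (!(readWire b a && readWire b c)) := by
  rcases a with _ | a
  · simp [nandGates, Circuit.run, readWire, Gate.act, ht]
  rcases c with _ | c
  · simp [nandGates, Circuit.run, readWire, Gate.act, ht]
  have ha' : a ≠ t := fun h => ha (by rw [h])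
  have hc' : c ≠ t := fun h => hc (by rw [h])
  by_cases h : a = c
  · subst h
    simp [nandGates, Circuit.run, readWire, Gate.act, ht, ha']
  · simp [nandGates, Circuit.run, readWire, Gate.act, ht, ha', hc', h]

/-- Evaluates NAND gates on the wires `ws`, writing the results to the wires `ts`. -/
def computeGates : List W → List (ℕ × ℕ) → List W → Circuit W
  | ws, g :: gs, t :: ts => nandGates ws[g.1]? ws[g.2]? t ++ computeGates (ws ++ [t]) gs ts
  | _, _, _ => []

theorem length_computeGates (ws : List W) (gs : List (ℕ × ℕ)) (ts : List W) :
    (computeGates ws gs ts).length ≤ 2 * gs.length := by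
  induction gs generalizing ws ts with
  | nil => simp [computeGates]
  | cons g gs ih =>
    cases ts with
    | nil => simp [computeGates]
    | cons t ts =>
      have := ih (ws ++ [t]) ts
      have := length_nandGates ws[g.1]? ws[g.2]? t
      simp only [computeGates, List.length_append, List.length_cons]
      omega

theorem isClassical_of_mem_computeGates (ws : List W) (gs : List (ℕ × ℕ)) (ts : List W) :
    ∀ g ∈ computeGates ws gs ts, g.IsClassical := by
  induction gs generalizing ws ts with
  | nil => simp [computeGates]
  | cons g gs ih =>
    cases ts with
    | nil => simp [computeGates]
    | cons t ts =>
      intro g' hg'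
      rcases List.mem_append.1 hg' with h | h
      · exact isClassical_of_mem_nandGates _ _ _ _ h
      · exact ih _ _ _ h

theorem readWire_getElem? (b : W → Bool) (ws : List W) (i : ℕ) :
    readWire b ws[i]? = (ws.map b).getD i false := by
  simp [readWire, List.getD_eq_getElem?_getD]

/-- The wire list grows by one target per gate, which matches the numbering of wires in
`BoolCircuit`. Distinctness ensures that a gate changes none of the wires computed before. A wire
number beyond the current list reads as `false` on both sides. -/
theorem run_computeGates (ws : List W) (gs : List (ℕ × ℕ)) (ts : List W)
    (hlen : ts.length = gs.length) (hnd : (ws ++ ts).Nodup) (b : W → Bool)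
    (hb : ∀ t ∈ ts, b t = false) :
    (ws ++ ts).map (Circuit.run (computeGates ws gs ts) b) =
        gs.foldl (fun vs g => vs ++ [!(vs.getD g.1 false && vs.getD g.2 false)]) (ws.map b) ∧
      ∀ w ∉ ts, Circuit.run (computeGates ws gs ts) b w = b w := by
  induction gs generalizing ws ts b with
  | nil =>
    obtain rfl : ts = [] := List.length_eq_zero_iff.1 hlen
    simp [computeGates, Circuit.run]
  | cons g gs ih =>
    obtain _ | ⟨t, ts⟩ := ts
    · simp at hlen
    have hassoc : ws ++ t :: ts = ws ++ [t] ++ ts := by simp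
    rw [hassoc] at hnd
    have hws : t ∉ ws := by
      have := (List.nodup_append.1 hnd).1
      intro h
      exact (List.nodup_append.1 this).2.2 t h t (by simp) rfl
    have hts : t ∉ ts := fun h => (List.nodup_append.1 hnd).2.2 t (by simp) t h rfl
    have hget : ∀ i : ℕ, ws[i]? ≠ some t := fun i h => hws (List.mem_of_getElem? h)
    have hrun := run_nandGates ws[g.1]? ws[g.2]? t (hget _) (hget _) b (hb t (by simp))
    rw [readWire_getElem?, readWire_getElem?] at hrun
    have key := ih (ws ++ [t]) ts (by simpa using hlen) hnd
      (Circuit.run (nandGates ws[g.1]? ws[g.2]? t) b) (by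
        intro w hw
        have hwt : w ≠ t := by rintro rfl; exact hts hw
        rw [hrun, Function.update_of_ne hwt]
        exact hb w (by simp [hw]))
    have hmap : (ws ++ [t]).map (Circuit.run (nandGates ws[g.1]? ws[g.2]? t) b) =
        ws.map b ++ [!((ws.map b).getD g.1 false && (ws.map b).getD g.2 false)] := by
      rw [hrun, List.map_append]
      congr 1
      · exact List.map_congr_left fun w hw =>
          Function.update_of_ne (by rintro rfl; exact hws hw) _ _
      · simp
    constructor
    · rw [computeGates, Circuit.run_append, hassoc, key.1, hmap, List.foldl_cons]
    · intro w hw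
      rw [computeGates, Circuit.run_append, key.2 w (fun h => hw (by simp [h])), hrun,
        Function.update_of_ne (fun h => hw (by simp [h]))]

/-- Adds the optional wire `a` to the wire `t`. -/
def copyGate (a : Option W) (t : W) : Circuit W :=
  match a with
  | some a => if h : a ≠ t then [Gate.cnot a t h] else []
  | none => []

/-- Adds the wires `src j` to the wires `tgt j`. -/
def copyGates {k : ℕ} (src : Fin k → Option W) (tgt : Fin k → W) : Circuit W :=
  (List.finRange k).flatMap fun j => copyGate (src j) (tgt j)

theorem length_copyGate (a : Option W) (t : W) : (copyGate a t).length ≤ 1 := by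
  unfold copyGate
  split
  · split_ifs <;> simp
  · simp

theorem length_copyGates {k : ℕ} (src : Fin k → Option W) (tgt : Fin k → W) :
    (copyGates src tgt).length ≤ k := by
  rw [copyGates, List.length_flatMap]
  refine (List.sum_le_card_nsmul _ 1 ?_).trans (by simp)
  simp only [List.mem_map]
  rintro _ ⟨j, -, rfl⟩
  exact length_copyGate _ _

theorem isClassical_of_mem_copyGates {k : ℕ} (src : Fin k → Option W) (tgt : Fin k → W) :
    ∀ g ∈ copyGates src tgt, g.IsClassical := by
  intro g hg
  obtain ⟨j, -, hj⟩ := List.mem_flatMap.1 hg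
  unfold copyGate at hj
  split at hj
  · split_ifs at hj
    · rw [List.mem_singleton.1 hj]; trivial
    · simp at hj
  · simp at hj

theorem pull_copyGate (a : Option W) (t : W) (ha : a ≠ some t) (b : W → Bool) :
    Circuit.pull (copyGate a t) b = Function.update b t (xor (b t) (readWire b a)) := by
  rcases a with _ | a
  · simp [copyGate, Circuit.pull, readWire]
  · have : a ≠ t := fun h => ha (by rw [h])
    simp [copyGate, Circuit.pull, readWire, this, Gate.act]

theorem pull_copyGates {k : ℕ} (src : Fin k → Option W) (tgt : Fin k → W)
    (hinj : Function.Injective tgt) (hdisj : ∀ i j, src i ≠ some (tgt j)) (b : W → Bool) :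
    Circuit.pull (copyGates src tgt) b =
      Function.extend tgt (fun j => xor (b (tgt j)) (readWire b (src j))) b := by
  -- The induction needs sublists: after the copies in `l`, exactly the targets indexed by `l` have
  -- changed, so every source still has its original value.
  have key : ∀ l : List (Fin k), l.Nodup → ∀ w,
      Circuit.pull (l.flatMap fun j => copyGate (src j) (tgt j)) b w =
        if ∃ j ∈ l, tgt j = w then
          Function.extend tgt (fun j => xor (b (tgt j)) (readWire b (src j))) b w else b w := by
    intro l
    induction l with
    | nil => intro _ w; simp [Circuit.pull]
    | cons i l ih =>
      intro hl w
      obtain ⟨hi, hl⟩ := List.nodup_cons.1 hl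
      have ih := ih hl
      rw [List.flatMap_cons, Circuit.pull_append, pull_copyGate _ _ (hdisj i i)]
      have hread : readWire (Circuit.pull (l.flatMap fun j => copyGate (src j) (tgt j)) b) (src i)
          = readWire b (src i) := by
        rcases h : src i with _ | a
        · rfl
        · have : ¬ ∃ j ∈ l, tgt j = a := by
            rintro ⟨j, -, rfl⟩
            exact hdisj i j h
          simp [readWire, ih, this]
      rw [hread]
      by_cases hw : tgt i = w
      · subst hw
        have : ¬ ∃ j ∈ l, tgt j = tgt i := by
          rintro ⟨j, hj, h⟩
          exact hi (hinj h ▸ hj)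
        simp [ih, this, hinj.extend_apply]
      · rw [Function.update_of_ne (Ne.symm hw), ih]
        simp [hw]
  ext w
  rw [copyGates, key _ (List.nodup_finRange k)]
  split_ifs with h
  · rfl
  · rw [Function.extend_apply']
    rintro ⟨j, rfl⟩
    exact h ⟨j, List.mem_finRange j, rfl⟩

/-! ### Compute, copy, uncompute. -/

namespace BoolCircuit

variable {n k : ℕ} (C : BoolCircuit n k)

/-- The reversible evaluation of `C` on the register `inp`: the result is added to the register
`tgt`, and the scratch wires `scr` are reset to `0`. -/
def toCircuit (inp : Fin n → W) (scr : Fin C.gates.length → W) (tgt : Fin k → W) : Circuit W :=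
  computeGates (List.ofFn inp) C.gates (List.ofFn scr) ++
    (copyGates (fun j => (List.ofFn inp ++ List.ofFn scr)[C.outputs j]?) tgt ++
      (computeGates (List.ofFn inp) C.gates (List.ofFn scr)).reverse)

theorem length_toCircuit (inp : Fin n → W) (scr : Fin C.gates.length → W) (tgt : Fin k → W) :
    (C.toCircuit inp scr tgt).length ≤ 4 * C.gates.length + k := by
  have h₁ := length_computeGates (List.ofFn inp) C.gates (List.ofFn scr)
  have h₂ := length_copyGates (fun j => (List.ofFn inp ++ List.ofFn scr)[C.outputs j]?) tgt
  simp only [toCircuit, List.length_append, List.length_reverse]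
  omega

variable {C} {inp : Fin n → W} {scr : Fin C.gates.length → W} {tgt : Fin k → W}

theorem isClassical_of_mem_toCircuit : ∀ g ∈ C.toCircuit inp scr tgt, g.IsClassical := by
  intro g hg
  simp only [toCircuit, List.mem_append, List.mem_reverse] at hg
  rcases hg with h | h | h
  · exact isClassical_of_mem_computeGates _ _ _ _ h
  · exact isClassical_of_mem_copyGates _ _ _ h
  · exact isClassical_of_mem_computeGates _ _ _ _ h

/-- The input, scratch and target registers consist of distinct wires. -/
structure Layout (inp : Fin n → W) (scr : Fin C.gates.length → W) (tgt : Fin k → W) : Prop where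
  inp_inj : Function.Injective inp
  scr_inj : Function.Injective scr
  tgt_inj : Function.Injective tgt
  inp_ne_scr : ∀ i j, inp i ≠ scr j
  inp_ne_tgt : ∀ i j, inp i ≠ tgt j
  scr_ne_tgt : ∀ i j, scr i ≠ tgt j

theorem Layout.nodup (L : Layout inp scr tgt) : (List.ofFn inp ++ List.ofFn scr).Nodup := by
  refine List.nodup_append.2 ⟨List.nodup_ofFn.2 L.inp_inj, List.nodup_ofFn.2 L.scr_inj, ?_⟩
  simp only [List.mem_ofFn]
  rintro _ ⟨i, rfl⟩ _ ⟨j, rfl⟩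
  exact L.inp_ne_scr i j

theorem Layout.src_ne_tgt (L : Layout inp scr tgt) (i : ℕ) (j : Fin k) :
    (List.ofFn inp ++ List.ofFn scr)[i]? ≠ some (tgt j) := by
  intro h
  have := List.mem_of_getElem? h
  simp only [List.mem_append, List.mem_ofFn] at this
  rcases this with ⟨i, h⟩ | ⟨i, h⟩
  · exact L.inp_ne_tgt _ _ h
  · exact L.scr_ne_tgt _ _ h

/-- The circuit is the copy step conjugated by the computation, and adding the same values twice
cancels. Clean scratch is not needed here, so the involution also covers the dirty basis states in
`apply_toCircuit`. -/
theorem pull_toCircuit_pull (L : Layout inp scr tgt) (b : W → Bool) :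
    Circuit.pull (C.toCircuit inp scr tgt) (Circuit.pull (C.toCircuit inp scr tgt) b) = b := by
  simp only [toCircuit, Circuit.pull_append, Circuit.pull_reverse, Circuit.run_pull]
  rw [pull_copyGates _ _ L.tgt_inj (fun i j => L.src_ne_tgt _ j),
    pull_copyGates _ _ L.tgt_inj (fun i j => L.src_ne_tgt _ j)]
  conv_rhs => rw [← Circuit.pull_run (computeGates (List.ofFn inp) C.gates (List.ofFn scr)) b]
  congr 1
  set b₁ := Circuit.run (computeGates (List.ofFn inp) C.gates (List.ofFn scr)) b
  have hread : ∀ (f : Fin k → Bool) (j : Fin k),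
      readWire (Function.extend tgt f b₁) (List.ofFn inp ++ List.ofFn scr)[C.outputs j]? =
        readWire b₁ (List.ofFn inp ++ List.ofFn scr)[C.outputs j]? := by
    intro f j
    rcases h : (List.ofFn inp ++ List.ofFn scr)[C.outputs j]? with _ | a
    · rfl
    · have : ¬ ∃ i, tgt i = a := by
        rintro ⟨i, rfl⟩
        exact L.src_ne_tgt _ _ h
      simp [readWire, Function.extend_apply' _ _ _ this]
  ext w
  by_cases hw : ∃ j, tgt j = w
  · obtain ⟨j, rfl⟩ := hw
    simp only [L.tgt_inj.extend_apply, hread]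
    simp
  · simp only [Function.extend_apply' _ _ _ hw]

theorem pull_toCircuit (L : Layout inp scr tgt) (b : W → Bool) (hb : ∀ j, b (scr j) = false) :
    Circuit.pull (C.toCircuit inp scr tgt) b =
      Function.extend tgt (fun j => xor (b (tgt j)) (C.eval (fun i => b (inp i)) j)) b := by
  simp only [toCircuit, Circuit.pull_append, Circuit.pull_reverse]
  rw [pull_copyGates _ _ L.tgt_inj (fun i j => L.src_ne_tgt _ j)]
  set b' := Function.extend tgt (fun j => xor (b (tgt j)) (C.eval (fun i => b (inp i)) j)) b with hb'
  -- Comparing both sides before the uncomputation: it remains to see that computing after the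
  -- target has been changed gives the same wires as computing first and changing the target then.
  conv_rhs => rw [← Circuit.pull_run (computeGates (List.ofFn inp) C.gates (List.ofFn scr)) b']
  congr 1
  have hinp : ∀ i, b' (inp i) = b (inp i) := fun i =>
    Function.extend_apply' _ _ _ fun ⟨j, h⟩ => L.inp_ne_tgt i j h.symm
  have hscr : ∀ i, b' (scr i) = b (scr i) := fun i =>
    Function.extend_apply' _ _ _ fun ⟨j, h⟩ => L.scr_ne_tgt i j h.symm
  have h₁ := run_computeGates (List.ofFn inp) C.gates (List.ofFn scr) (by simp) L.nodup b
    (by simpa [List.mem_ofFn] using hb)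
  have h₂ := run_computeGates (List.ofFn inp) C.gates (List.ofFn scr) (by simp) L.nodup b'
    (by simpa [List.mem_ofFn, hscr] using hb)
  have hsame : (List.ofFn inp).map b' = (List.ofFn inp).map b := by
    simp [List.map_ofFn, Function.comp_def, hinp]
  rw [hsame, ← h₁.1] at h₂
  have hval : ∀ j, readWire (Circuit.run (computeGates (List.ofFn inp) C.gates (List.ofFn scr)) b)
      (List.ofFn inp ++ List.ofFn scr)[C.outputs j]? = C.eval (fun i => b (inp i)) j := by
    intro j
    rw [readWire_getElem?, h₁.1, List.map_ofFn]
    rfl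
  ext w
  by_cases hw : ∃ j, tgt j = w
  · obtain ⟨j, rfl⟩ := hw
    have hns : tgt j ∉ List.ofFn scr := by
      simp only [List.mem_ofFn]
      rintro ⟨i, h⟩
      exact L.scr_ne_tgt _ _ h
    rw [L.tgt_inj.extend_apply, hval, h₁.2 _ hns, h₂.2 _ hns, hb', L.tgt_inj.extend_apply]
  · rw [Function.extend_apply' _ _ _ hw]
    by_cases hm : w ∈ List.ofFn inp ++ List.ofFn scr
    · exact (List.map_inj_left.1 h₂.1 w hm).symm
    · have hns : w ∉ List.ofFn scr := fun h => hm (List.mem_append_right _ h)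
      rw [h₁.2 _ hns, h₂.2 _ hns, hb', Function.extend_apply' _ _ _ hw]

/-- On states with clean scratch wires, `C.toCircuit` adds the value of `C` to the target. -/
theorem apply_toCircuit (L : Layout inp scr tgt) (ψ : QState W)
    (hψ : ∀ b, ψ b ≠ 0 → ∀ j, b (scr j) = false) (b : W → Bool) :
    Circuit.apply (C.toCircuit inp scr tgt) ψ b =
      if ∀ j, b (scr j) = false then
        ψ (Function.extend tgt (fun j => xor (b (tgt j)) (C.eval (fun i => b (inp i)) j)) b)
      else 0 := by
  rw [Circuit.apply_eq_pull _ isClassical_of_mem_toCircuit]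
  split_ifs with h
  · rw [pull_toCircuit L b h]
  -- A nonzero amplitude at `b` comes from a clean basis state. The circuit preserves clean scratch
  -- and is an involution, so `b` itself would be clean.
  · by_contra h0
    refine h fun j => ?_
    have hz := hψ _ h0
    rw [← pull_toCircuit_pull L b, pull_toCircuit L _ hz,
      Function.extend_apply' _ _ _ fun ⟨i, h⟩ => L.scr_ne_tgt j i h.symm]
    exact hz j

end BoolCircuit

end Classical

/-! ### Linearity, and registers that a circuit does not touch -/

section Linear

set_option linter.unusedSectionVars false

variable {W : Type} [DecidableEq W]

theorem Gate.apply_smul (g : Gate W) (a : ℂ) (ψ : QState W) :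
    g.apply (a • ψ) = a • g.apply ψ := by
  ext b
  cases g <;> simp only [Gate.apply, Pi.smul_apply, smul_eq_mul] <;> ring

theorem Circuit.apply_smul (C : Circuit W) (a : ℂ) (ψ : QState W) :
    C.apply (a • ψ) = a • C.apply ψ := by
  induction C generalizing ψ with
  | nil => rfl
  | cons g C ih => rw [Circuit.apply_cons, Gate.apply_smul, ih, Circuit.apply_cons]

theorem Circuit.apply_zero (C : Circuit W) : C.apply (0 : QState W) = 0 := by
  simpa using C.apply_smul 0 0

theorem project_smul (S : Set (W → Bool)) (a : ℂ) (ψ : QState W) :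
    project S (a • ψ) = a • project S ψ :=
  Set.indicator_const_smul S a ψ

theorem normSq_smul [Fintype W] (a : ℂ) (ψ : QState W) :
    normSq (a • ψ) = ‖a‖ ^ 2 * normSq ψ := by
  simp [normSq, Finset.mul_sum, mul_pow]

/-- Probabilities are quadratic in the state; this turns the amplitude `2^(-m/2)` of a coin branch
into the probability `2^(-m)`. -/
theorem challengeProb_smul [Fintype W] {n : ℕ} (b : Bool) (reg : Fin n → W) (C : Circuit W)
    (out : W) (a : ℂ) (ψ : QState W) :
    challengeProb b reg C out (a • ψ) = ‖a‖ ^ 2 * challengeProb b reg C out ψ := by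
  cases b <;>
    simp [challengeProb, outputProb, project_smul, Circuit.apply_smul, normSq_smul, Finset.mul_sum]

/-- The qubit that a gate modifies. -/
def Gate.target : Gate W → W
  | .had w => w
  | .phaseT w => w
  | .not w => w
  | .cnot _ t _ => t
  | .toffoli _ _ t _ _ _ => t

/-- A gate only combines amplitudes of basis states that differ at most in its target, and `S` does
not separate such states. Controls are unrestricted. -/
theorem Gate.apply_project (g : Gate W) (S : Set (W → Bool))
    (hS : ∀ b v, Function.update b g.target v ∈ S ↔ b ∈ S) (ψ : QState W) :
    g.apply (project S ψ) = project S (g.apply ψ) := by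
  classical
  ext b
  cases g <;> simp only [Gate.target] at hS <;>
    by_cases h : b ∈ S <;> simp [Gate.apply, project, Set.indicator, hS, h]

theorem Circuit.apply_project (C : Circuit W) (S : Set (W → Bool))
    (hS : ∀ g ∈ C, ∀ b v, Function.update b g.target v ∈ S ↔ b ∈ S) (ψ : QState W) :
    C.apply (project S ψ) = project S (C.apply ψ) := by
  induction C generalizing ψ with
  | nil => rfl
  | cons g C ih =>
    rw [Circuit.apply_cons, Gate.apply_project g S (hS g List.mem_cons_self),
      ih (fun g' h => hS g' (List.mem_cons_of_mem _ h)), Circuit.apply_cons]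

theorem Gate.target_map {V : Type} [DecidableEq V] (f : V ↪ W) (g : Gate V) :
    (g.map f).target = f g.target := by
  cases g <;> rfl

/-- The measurement of a register commutes with a circuit on other qubits. -/
theorem apply_mapWires_project_regEq {V : Type} [DecidableEq V] (f : V ↪ W) (C : Circuit V) {n : ℕ}
    (reg : Fin n → W) (hreg : ∀ v j, f v ≠ reg j) (s : BitStr n) (ψ : QState W) :
    Circuit.apply (Circuit.mapWires f C) (project (regEq reg s) ψ) =
      project (regEq reg s) (Circuit.apply (Circuit.mapWires f C) ψ) := by
  refine Circuit.apply_project _ _ (fun g hg b v => ?_) ψ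
  obtain ⟨g, -, rfl⟩ := List.mem_map.1 hg
  rw [Gate.target_map]
  have : ∀ j, Function.update b (f g.target) v (reg j) = b (reg j) := fun j =>
    Function.update_of_ne (hreg _ j).symm _ _
  simp [regEq, this]

end Linear

/-! ### Slices of a state -/

section Slice

variable {B X W : Type} [DecidableEq B] [DecidableEq X] [DecidableEq W] (e : B ⊕ X ≃ W)

set_option linter.unusedSectionVars false

/-- The basis state of all qubits that consists of basis states of two subsystems. -/
def joinBits (p : B → Bool) (c : X → Bool) : W → Bool := fun w => Sum.elim p c (e.symm w)

@[simp] theorem joinBits_inl (p : B → Bool) (c : X → Bool) (x : B) :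
    joinBits e p c (e (.inl x)) = p x := by simp [joinBits]

@[simp] theorem joinBits_inr (p : B → Bool) (c : X → Bool) (x : X) :
    joinBits e p c (e (.inr x)) = c x := by simp [joinBits]

theorem bits_ext {b b' : W → Bool} (h₁ : ∀ x, b (e (.inl x)) = b' (e (.inl x)))
    (h₂ : ∀ x, b (e (.inr x)) = b' (e (.inr x))) : b = b' := by
  ext w
  obtain ⟨x | x, rfl⟩ := e.surjective w
  · rw [h₁]
  · rw [h₂]

theorem joinBits_inj {p p' : B → Bool} {c c' : X → Bool} :
    joinBits e p c = joinBits e p' c' ↔ p = p' ∧ c = c' := by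
  constructor
  · intro h
    constructor
    · ext x
      simpa using congrFun h (e (.inl x))
    · ext x
      simpa using congrFun h (e (.inr x))
  · rintro ⟨rfl, rfl⟩
    rfl

theorem joinBits_surj (b : W → Bool) :
    joinBits e (fun x => b (e (.inl x))) (fun x => b (e (.inr x))) = b :=
  bits_ext e (by simp) (by simp)

theorem update_joinBits_inl (p : B → Bool) (c : X → Bool) (x : B) (v : Bool) :
    Function.update (joinBits e p c) (e (.inl x)) v = joinBits e (Function.update p x v) c := by
  refine bits_ext e (fun y => ?_) (fun y => ?_)
  · by_cases h : y = x <;> simp [h]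
  · simp

theorem update_joinBits_inr (p : B → Bool) (c : X → Bool) (x : X) (v : Bool) :
    Function.update (joinBits e p c) (e (.inr x)) v = joinBits e p (Function.update c x v) := by
  refine bits_ext e (fun y => ?_) (fun y => ?_)
  · simp
  · by_cases h : y = x <;> simp [h]

/-- The unnormalised state of the first subsystem when the second one is in the basis state `c`. -/
def slice (ψ : QState W) (c : X → Bool) : QState B := fun p => ψ (joinBits e p c)

/-- The first subsystem. -/
def mainEmb : B ↪ W := Function.Embedding.inl.trans e.toEmbedding

/-- A circuit on the first subsystem acts on each branch of the second one independently; this is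
what allows reasoning with one coin value at a time. -/
theorem slice_apply_mapWires (C : Circuit B) (ψ : QState W) (c : X → Bool) :
    slice e (Circuit.apply (Circuit.mapWires (mainEmb e) C) ψ) c = C.apply (slice e ψ c) := by
  induction C generalizing ψ with
  | nil => rfl
  | cons g C ih =>
    change slice e (Circuit.apply (Circuit.mapWires (mainEmb e) C) ((g.map (mainEmb e)).apply ψ)) c
      = _
    rw [ih, Circuit.apply_cons]
    congr 1
    ext p
    cases g <;> simp [slice, Gate.apply, Gate.map, mainEmb, update_joinBits_inl]

theorem normSq_eq_sum_slice [Fintype B] [Fintype X] [Fintype W] (ψ : QState W) :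
    normSq ψ = ∑ c, normSq (slice e ψ c) := by
  simp only [normSq, slice]
  rw [Finset.sum_comm, ← Fintype.sum_prod_type']
  refine (Fintype.sum_bijective (fun x : (B → Bool) × (X → Bool) => joinBits e x.1 x.2)
    ⟨fun x y h => ?_, fun b => ⟨(_, _), joinBits_surj e b⟩⟩ _ _ fun _ => rfl).symm
  exact Prod.ext_iff.2 ((joinBits_inj e).1 h)

end Slice

/-! ### Uniform superpositions over the graph of a function -/

section Graph

variable {W : Type} [DecidableEq W]

set_option linter.unusedSectionVars false

/-- The superposition of the basis states `F r`, where `r` is the content of the register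
`coin`, with amplitude `a`. -/
noncomputable def graphState {m : ℕ} (coin : Fin m → W) (F : BitStr m → W → Bool) (a : ℂ) :
    QState W :=
  open Classical in fun b => if b = F (fun j => b (coin j)) then a else 0

/-- On a qubit in state 0 the Hadamard gate gives both values the same amplitude, so its sign never
enters and the result forgets the bits in `l`. -/
theorem apply_had_list (l : List W) (hl : l.Nodup) (ψ : QState W)
    (hψ : ∀ b, ψ b ≠ 0 → ∀ w ∈ l, b w = false) (b : W → Bool) :
    Circuit.apply (l.map Gate.had) ψ b =
      (1 / (Real.sqrt 2 : ℂ)) ^ l.length * ψ (fun w => if w ∈ l then false else b w) := by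
  induction l generalizing ψ b with
  | nil => simp [Circuit.apply]
  | cons w l ih =>
    obtain ⟨hw, hl⟩ := List.nodup_cons.1 hl
    have h1 : ∀ b, (Gate.had w).apply ψ b =
        (1 / (Real.sqrt 2 : ℂ)) * ψ (Function.update b w false) := by
      intro b
      have : ψ (Function.update b w true) = 0 := by
        by_contra h
        simpa using hψ _ h w (by simp)
      simp only [Gate.apply, this]
      ring
    rw [List.map_cons, Circuit.apply_cons, ih hl _ _ b, h1]
    · rw [List.length_cons, pow_succ, mul_assoc]
      congr 3
      ext v
      by_cases hv : v = w
      · subst hv; simp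
      · simp [hv]
    · intro b hb v hv
      rw [h1] at hb
      have := hψ _ (right_ne_zero_of_mul hb) v (by simp [hv])
      rwa [Function.update_of_ne (by rintro rfl; exact hw hv)] at this

theorem apply_had_ket {m : ℕ} (coin : Fin m → W) (hcoin : Function.Injective coin)
    (b₀ : W → Bool) (hb₀ : ∀ j, b₀ (coin j) = false) :
    Circuit.apply ((List.ofFn coin).map Gate.had) (ket b₀) =
      graphState coin (fun r => Function.extend coin r b₀) ((1 / (Real.sqrt 2 : ℂ)) ^ m) := by
  classical
  ext b
  rw [apply_had_list _ (List.nodup_ofFn.2 hcoin), List.length_ofFn, graphState]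
  · have : (fun w => if w ∈ List.ofFn coin then false else b w) = b₀ ↔
        b = Function.extend coin (fun j => b (coin j)) b₀ := by
      rw [funext_iff, funext_iff]
      refine forall_congr' fun w => ?_
      by_cases hw : ∃ j, coin j = w
      · obtain ⟨j, rfl⟩ := hw
        simp [hcoin.extend_apply, hb₀]
      · rw [Function.extend_apply' _ _ _ hw]
        simp only [List.mem_ofFn]
        rw [if_neg hw]
    simp only [ket, Set.indicator, Set.mem_singleton_iff, this]
    split_ifs <;> simp
  · intro b hb w hw
    have : b = b₀ := by
      by_contra h
      exact hb (by simp [ket, h])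
    obtain ⟨j, rfl⟩ := List.mem_ofFn.1 hw
    rw [this, hb₀]

/-- The coin register is only read, so the state stays a superposition over a graph with the same
amplitude. As the target starts at 0, adding the value amounts to writing it. -/
theorem BoolCircuit.apply_toCircuit_graphState {m k : ℕ} {C : BoolCircuit m k} {coin : Fin m → W}
    {scr : Fin C.gates.length → W} {tgt : Fin k → W} (L : BoolCircuit.Layout coin scr tgt)
    (F : BitStr m → W → Bool) (hscr : ∀ r j, F r (scr j) = false)
    (htgt : ∀ r j, F r (tgt j) = false) (a : ℂ) :
    Circuit.apply (C.toCircuit coin scr tgt) (graphState coin F a) =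
      graphState coin (fun r => Function.extend tgt (C.eval r) (F r)) a := by
  classical
  have hcoin : ∀ (f : Fin k → Bool) (b : W → Bool) i,
      Function.extend tgt f b (coin i) = b (coin i) := fun f b i =>
    Function.extend_apply' _ _ _ fun ⟨j, h⟩ => L.inp_ne_tgt i j h.symm
  ext b
  rw [apply_toCircuit L]
  · simp only [graphState, hcoin]
    by_cases hb : ∀ j, b (scr j) = false
    · rw [if_pos hb]
      congr 1
      rw [eq_iff_iff, funext_iff, funext_iff]
      refine forall_congr' fun w => ?_
      by_cases hw : ∃ j, tgt j = w
      · obtain ⟨j, rfl⟩ := hw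
        simp [L.tgt_inj.extend_apply, htgt]
      · simp [Function.extend_apply' _ _ _ hw]
    · rw [if_neg hb, if_neg]
      intro h
      refine hb fun j => ?_
      rw [h, Function.extend_apply' _ _ _ fun ⟨i, h⟩ => L.scr_ne_tgt j i h.symm, hscr]
  · intro b hb j
    have : b = F (fun j => b (coin j)) := by
      by_contra h
      exact hb (by simp [graphState, if_neg h])
    rw [this, hscr]

end Graph

/-! ### Removing the second verifier message -/

/-- The part of an interaction that follows a uniformly random message of length `m`: the prover
runs a circuit on qubits `B`, two Boolean circuits compute a query string from the message and a
decision from the message and the answers, and a distinguisher gets all qubits `B`. -/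
structure CoinReduction (B : Type) where
  m : ℕ
  nq : ℕ
  a : ℕ
  queryCirc : BoolCircuit m nq
  decideCirc : BoolCircuit (m + a) 1
  chalReg : Fin m → B
  chalReg_inj : Function.Injective chalReg
  ansReg : Fin a → B
  ansReg_inj : Function.Injective ansReg
  prover : Circuit B
  dist : Circuit B
  out : B

namespace CoinReduction

section

set_option linter.unusedSectionVars false

variable {B : Type} (T : CoinReduction B)

/-- The additional qubits: the random message, the query string, scratch space for both circuits,
a flag (`false`) for the decision and the final output (`true`). -/
abbrev Extra : Type :=
  Fin T.m ⊕ (Fin T.nq ⊕ (Fin T.queryCirc.gates.length ⊕ (Fin T.decideCirc.gates.length ⊕ Bool)))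

variable {W : Type} (e : B ⊕ T.Extra ≃ W)

def coinW (j : Fin T.m) : W := e (.inr (.inl j))

def queryW (j : Fin T.nq) : W := e (.inr (.inr (.inl j)))

def scratch₁W (j : Fin T.queryCirc.gates.length) : W := e (.inr (.inr (.inr (.inl j))))

def scratch₂W (j : Fin T.decideCirc.gates.length) : W := e (.inr (.inr (.inr (.inr (.inl j)))))

def flagW : W := e (.inr (.inr (.inr (.inr (.inr false)))))

def outW : W := e (.inr (.inr (.inr (.inr (.inr true)))))

def chalW (j : Fin T.m) : W := e (.inl (T.chalReg j))

def decideInW : Fin (T.m + T.a) → W :=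
  Fin.append (T.coinW e) (fun j => e (.inl (T.ansReg j)))

/-- The Boolean circuit that copies its input. -/
def idCirc (m : ℕ) : BoolCircuit m m := ⟨[], fun j => j⟩

theorem eval_idCirc {m : ℕ} (r : BitStr m) : (idCirc m).eval r = r := by
  ext j
  simp [BoolCircuit.eval, BoolCircuit.values, idCirc]

/-- The values of the additional qubits if the random message is `r`. -/
def good (φ o : Bool) (r : BitStr T.m) : T.Extra → Bool :=
  Sum.elim r (Sum.elim (T.queryCirc.eval r) (Sum.elim (fun _ => false) (Sum.elim (fun _ => false)
    fun x => bif x then o else φ)))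

theorem good_inj {φ o φ' o' : Bool} {r r' : BitStr T.m} (h : T.good φ o r = T.good φ' o' r') :
    r = r' ∧ φ = φ' ∧ o = o' := by
  refine ⟨funext fun j => congrFun h (.inl j), ?_, ?_⟩
  · exact congrFun h (.inr (.inr (.inr (.inr false))))
  · exact congrFun h (.inr (.inr (.inr (.inr true))))

/-! ### The circuits of the reduction and their register layouts. -/

variable [DecidableEq W]

/-- Samples the random message, and computes the query string from it. -/
def prepare : Circuit W :=
  (List.ofFn (T.coinW e)).map Gate.had ++
    ((idCirc T.m).toCircuit (T.coinW e) Fin.elim0 (T.chalW e) ++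
      T.queryCirc.toCircuit (T.coinW e) (T.scratch₁W e) (T.queryW e))

/-- Computes the decision. -/
def check : Circuit W :=
  T.decideCirc.toCircuit (T.decideInW e) (T.scratch₂W e) (fun _ => T.flagW e)

/-- Samples the random message, computes the query string from it, runs the prover and computes the
decision. -/
def stage₁ : Circuit W :=
  T.prepare e ++ (Circuit.mapWires (mainEmb e) T.prover ++ T.check e)

/-- Runs the distinguisher and computes the conjunction of its output with the decision. -/
def stage₂ : Circuit W :=
  Circuit.mapWires (mainEmb e) T.dist ++
    [Gate.toffoli (T.flagW e) (e (.inl T.out)) (T.outW e) (by simp [flagW]) (by simp [flagW, outW])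
      (by simp [outW])]

theorem length_stage₁ : (T.stage₁ e).length ≤
    2 * T.m + 4 * T.queryCirc.size + T.prover.length + 4 * T.decideCirc.size := by
  have h₁ := (idCirc T.m).length_toCircuit (T.coinW e) Fin.elim0 (T.chalW e)
  have h₂ := T.queryCirc.length_toCircuit (T.coinW e) (T.scratch₁W e) (T.queryW e)
  have h₃ := T.decideCirc.length_toCircuit (T.decideInW e) (T.scratch₂W e) (fun _ => T.flagW e)
  have h₄ : (idCirc T.m).gates.length = 0 := rfl
  simp only [stage₁, prepare, check, List.length_append, List.length_map, List.length_ofFn,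
    Circuit.mapWires, BoolCircuit.size]
  omega

theorem length_stage₂ : (T.stage₂ e).length = T.dist.length + 1 := by
  simp [stage₂, Circuit.mapWires]

theorem coinW_inj : Function.Injective (T.coinW e) := fun i j h => by
  simpa [coinW] using h

theorem layout_copy :
    BoolCircuit.Layout (C := idCirc T.m) (T.coinW e) Fin.elim0 (T.chalW e) where
  inp_inj := T.coinW_inj e
  scr_inj := fun i => i.elim0
  tgt_inj := fun i j h => T.chalReg_inj (by simpa [chalW] using h)
  inp_ne_scr := fun _ j => j.elim0
  inp_ne_tgt := by simp [coinW, chalW]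
  scr_ne_tgt := fun i => i.elim0

theorem layout_query :
    BoolCircuit.Layout (C := T.queryCirc) (T.coinW e) (T.scratch₁W e) (T.queryW e) where
  inp_inj := T.coinW_inj e
  scr_inj := fun i j h => by simpa [scratch₁W] using h
  tgt_inj := fun i j h => by simpa [queryW] using h
  inp_ne_scr := by simp [coinW, scratch₁W]
  inp_ne_tgt := by simp [coinW, queryW]
  scr_ne_tgt := by simp [scratch₁W, queryW]

theorem layout_check :
    BoolCircuit.Layout (C := T.decideCirc) (T.decideInW e) (T.scratch₂W e)
      (fun _ => T.flagW e) where
  inp_inj := by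
    refine Fin.append_injective_iff.2 ⟨T.coinW_inj e, fun i j h => T.ansReg_inj (by simpa using h),
      fun i j => by simp [coinW]⟩
  scr_inj := fun i j h => by simpa [scratch₂W] using h
  tgt_inj := fun i j _ => Subsingleton.elim i j
  inp_ne_scr := fun i j => by
    refine Fin.addCases (fun i => ?_) (fun i => ?_) i <;> simp [decideInW, coinW, scratch₂W]
  inp_ne_tgt := fun i j => by
    refine Fin.addCases (fun i => ?_) (fun i => ?_) i <;> simp [decideInW, coinW, flagW]
  scr_ne_tgt := by simp [scratch₂W, flagW]

variable [DecidableEq B]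

/-- The prover gets a copy of the coins, because it may overwrite its challenge register while the
decision and the orthogonality of branches need the original. -/
theorem apply_prepare (b₀ : B → Bool) (hb₀ : ∀ j, b₀ (T.chalReg j) = false) :
    Circuit.apply (T.prepare e) (ket (joinBits e b₀ fun _ => false)) =
      graphState (T.coinW e)
        (fun r => joinBits e (Function.extend T.chalReg r b₀) (T.good false false r))
        ((1 / (Real.sqrt 2 : ℂ)) ^ T.m) := by
  have hne : ∀ (w : T.Extra), ¬ ∃ j, T.chalW e j = e (.inr w) := by simp [chalW]
  have hne' : ∀ (w : B), ¬ ∃ j, T.coinW e j = e (.inl w) := by simp [coinW]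
  have hneq : ∀ (w : B), ¬ ∃ j, T.queryW e j = e (.inl w) := by simp [queryW]
  rw [prepare, Circuit.apply_append, Circuit.apply_append,
    apply_had_ket _ (T.coinW_inj e) _ (by simp [coinW]),
    BoolCircuit.apply_toCircuit_graphState (T.layout_copy e) _ (fun _ j => j.elim0)
      (fun r j => by
        rw [chalW, Function.extend_apply' _ _ _ (hne' _), joinBits_inl, hb₀]),
    BoolCircuit.apply_toCircuit_graphState (T.layout_query e)]
  · congr 1
    ext1 r
    refine bits_ext e (fun x => ?_) (fun x => ?_)
    · rw [Function.extend_apply' _ _ _ (hneq _), joinBits_inl]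
      by_cases hx : ∃ j, T.chalReg j = x
      · obtain ⟨j, rfl⟩ := hx
        rw [T.chalReg_inj.extend_apply]
        exact ((T.layout_copy e).tgt_inj.extend_apply _ _ j).trans (by rw [eval_idCirc])
      · rw [Function.extend_apply' _ _ _ hx, Function.extend_apply' _ _ _ (by
          rintro ⟨j, h⟩
          exact hx ⟨j, by simpa [chalW] using h⟩), Function.extend_apply' _ _ _ (hne' _),
          joinBits_inl]
    · rw [joinBits_inr]
      obtain j | j | x := x
      · rw [Function.extend_apply' _ _ _ (by simp [queryW]), Function.extend_apply' _ _ _ (hne _)]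
        exact (T.coinW_inj e).extend_apply _ _ j
      · exact (T.layout_query e).tgt_inj.extend_apply _ _ j
      · rw [Function.extend_apply' _ _ _ (by simp [queryW]), Function.extend_apply' _ _ _ (hne _),
          Function.extend_apply' _ _ _ (by simp [coinW]), joinBits_inr]
        rcases x with x | x | _ | _ <;> rfl
  · intro r j
    rw [scratch₁W, Function.extend_apply' _ _ _ (hne _),
      Function.extend_apply' _ _ _ (by simp [coinW]), joinBits_inr]
  · intro r j
    rw [queryW, Function.extend_apply' _ _ _ (hne _),
      Function.extend_apply' _ _ _ (by simp [coinW]), joinBits_inr]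

-- In the branch with coins `r`, the prover behaves as on the classical challenge `r`; extra qubits
-- that fit no `r` carry no amplitude.
open Classical in
theorem slice_prover (b₀ : B → Bool) (hb₀ : ∀ j, b₀ (T.chalReg j) = false) (c : T.Extra → Bool) :
    slice e (Circuit.apply (Circuit.mapWires (mainEmb e) T.prover)
      (Circuit.apply (T.prepare e) (ket (joinBits e b₀ fun _ => false)))) c =
    if c = T.good false false (fun j => c (.inl j)) then
      ((1 / (Real.sqrt 2 : ℂ)) ^ T.m) •
        Circuit.apply T.prover (ket (Function.extend T.chalReg (fun j => c (.inl j)) b₀))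
    else 0 := by
  rw [slice_apply_mapWires, apply_prepare T e b₀ hb₀]
  have : slice e (graphState (T.coinW e)
        (fun r => joinBits e (Function.extend T.chalReg r b₀) (T.good false false r))
        ((1 / (Real.sqrt 2 : ℂ)) ^ T.m)) c =
      if c = T.good false false (fun j => c (.inl j)) then
        ((1 / (Real.sqrt 2 : ℂ)) ^ T.m) •
          ket (Function.extend T.chalReg (fun j => c (.inl j)) b₀) else 0 := by
    ext p
    simp only [slice, graphState, coinW, joinBits_inr, joinBits_inj]
    by_cases hc : c = T.good false false (fun j => c (.inl j))
    · rw [if_pos hc]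
      rw [Pi.smul_apply, ket, Set.indicator_apply]
      simp [← hc]
    · simp [hc]
  rw [this]
  split_ifs
  · rw [Circuit.apply_smul]
  · rw [Circuit.apply_zero]

/-- The decision circuit changes no extra qubit but the flag. This supplies the support hypothesis
for the analysis of the second stage. -/
theorem apply_stage₁_support (b₀ : B → Bool) (hb₀ : ∀ j, b₀ (T.chalReg j) = false)
    (p : B → Bool) (c : T.Extra → Bool)
    (h : Circuit.apply (T.stage₁ e) (ket (joinBits e b₀ fun _ => false)) (joinBits e p c) ≠ 0) :
    ∃ φ r, c = T.good φ false r := by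
  classical
  have hsl := T.slice_prover e b₀ hb₀
  rw [stage₁, Circuit.apply_append, Circuit.apply_append] at h
  set Ψ := Circuit.apply (Circuit.mapWires (mainEmb e) T.prover)
      (Circuit.apply (T.prepare e) (ket (joinBits e b₀ fun _ => false)))
  have hΨ : ∀ p c, Ψ (joinBits e p c) ≠ 0 → c = T.good false false (fun j => c (.inl j)) := by
    intro p c h
    by_contra hc
    exact h (by simpa [hc, slice] using congrFun (hsl c) p)
  rw [check, BoolCircuit.apply_toCircuit (T.layout_check e)] at h
  · split_ifs at h with hs
    · have hj : Function.extend (fun _ : Fin 1 => T.flagW e)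
          (fun j => xor (joinBits e p c (T.flagW e))
            (T.decideCirc.eval (fun i => joinBits e p c (T.decideInW e i)) j)) (joinBits e p c) =
          Function.update (joinBits e p c) (T.flagW e) (xor (joinBits e p c (T.flagW e))
            (T.decideCirc.eval (fun i => joinBits e p c (T.decideInW e i)) 0)) := by
        ext w
        by_cases hw : w = T.flagW e
        · subst hw
          rw [Function.update_self]
          exact (T.layout_check e).tgt_inj.extend_apply _ _ 0
        · rw [Function.update_of_ne hw, Function.extend_apply' _ _ _ (fun ⟨_, h⟩ => hw h.symm)]
      rw [hj, flagW, update_joinBits_inr] at h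
      have h := hΨ _ _ h
      refine ⟨c (.inr (.inr (.inr (.inr false)))), fun j => c (.inl j), ?_⟩
      ext x
      by_cases hx : x = .inr (.inr (.inr (.inr false)))
      · subst hx
        rfl
      · have := congrFun h x
        rw [Function.update_of_ne hx] at this
        rw [this]
        rcases x with x | x | x | x | _ | _ <;> first | exact absurd rfl hx | rfl
    · exact absurd rfl h
  · intro b hb j
    rw [← joinBits_surj e b] at hb
    have := congrFun (hΨ _ _ hb) (.inr (.inr (.inr (.inl j))))
    exact this

/-- The branch of the state after `stage₁` in which the random message is `r` and the decision is
positive. -/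
theorem slice_apply_stage₁ (b₀ : B → Bool) (hb₀ : ∀ j, b₀ (T.chalReg j) = false)
    (r : BitStr T.m) :
    slice e (Circuit.apply (T.stage₁ e) (ket (joinBits e b₀ fun _ => false)))
      (T.good true false r) =
    ((1 / (Real.sqrt 2 : ℂ)) ^ T.m) •
      project {p | T.decideCirc.eval (Fin.append r fun j => p (T.ansReg j)) 0 = true}
        (Circuit.apply T.prover (ket (Function.extend T.chalReg r b₀))) := by
  classical
  have hsl := T.slice_prover e b₀ hb₀
  rw [stage₁, Circuit.apply_append, Circuit.apply_append]
  set Ψ := Circuit.apply (Circuit.mapWires (mainEmb e) T.prover)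
      (Circuit.apply (T.prepare e) (ket (joinBits e b₀ fun _ => false)))
  have hΨ : ∀ p c, Ψ (joinBits e p c) ≠ 0 → c = T.good false false (fun j => c (.inl j)) := by
    intro p c h
    by_contra hc
    exact h (by simpa [hc, slice] using congrFun (hsl c) p)
  ext p
  rw [slice, check, BoolCircuit.apply_toCircuit (T.layout_check e), if_pos]
  · have hin : (fun i => joinBits e p (T.good true false r) (T.decideInW e i)) =
        Fin.append r fun j => p (T.ansReg j) := by
      ext i
      refine Fin.addCases (fun i => ?_) (fun i => ?_) i
      · simp [decideInW, coinW, good]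
      · simp [decideInW]
    set d := T.decideCirc.eval (Fin.append r fun j => p (T.ansReg j)) 0 with hd
    -- Before the decision `d` was added, a flag that is now 1 had the value `!d`. Since the flag
    -- started at 0, the amplitude vanishes unless `d` is true.
    have hj : Function.extend (fun _ : Fin 1 => T.flagW e)
          (fun j => xor (joinBits e p (T.good true false r) (T.flagW e))
            (T.decideCirc.eval (fun i => joinBits e p (T.good true false r) (T.decideInW e i)) j))
          (joinBits e p (T.good true false r)) =
        joinBits e p (T.good (!d) false r) := by
      refine bits_ext e (fun x => ?_) (fun x => ?_)
      · rw [Function.extend_apply' _ _ _ (by simp [flagW]), joinBits_inl, joinBits_inl]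
      · rw [joinBits_inr]
        by_cases hx : x = .inr (.inr (.inr (.inr false)))
        · subst hx
          refine ((T.layout_check e).tgt_inj.extend_apply _ _ 0).trans ?_
          rw [hin, ← hd]
          simp [flagW, good]
        · rw [Function.extend_apply' _ _ _ (fun ⟨_, h⟩ => hx (by simpa [flagW] using h.symm)),
            joinBits_inr]
          rcases x with x | x | x | x | _ | _ <;> first | exact absurd rfl hx | rfl
    rw [hj]
    by_cases hdt : d = true
    · have h := congrFun (hsl (T.good false false r)) p
      rw [hdt]
      refine h.trans ((congrFun (if_pos rfl) p).trans ?_)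
      have hp : p ∈ {p | T.decideCirc.eval (Fin.append r fun j => p (T.ansReg j)) 0 = true} := hdt
      simp only [Pi.smul_apply, project, Set.indicator_of_mem hp]
      rfl
    · have hp : p ∉ {p | T.decideCirc.eval (Fin.append r fun j => p (T.ansReg j)) 0 = true} := hdt
      simp only [Pi.smul_apply, project, Set.indicator_of_notMem hp, smul_zero]
      by_contra h
      have := (T.good_inj (hΨ _ _ h)).2.1
      simp at this
      exact hdt this
  · intro j
    simp [scratch₂W, good]
  · intro b hb j
    rw [← joinBits_surj e b] at hb
    exact congrFun (hΨ _ _ hb) (.inr (.inr (.inr (.inl j))))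

/-! ### Output probabilities as sums over the random message. -/

variable [Fintype B] [Fintype W]

/-- The output qubit starts at 0, so it ends at 1 only where the flag is 1 and the distinguisher
outputs 1. Different `r` occupy different values of the extra qubits, hence there is no interference
and squared norms add. -/
theorem outputProb_stage₂ (ψ : QState W)
    (hψ : ∀ p c, ψ (joinBits e p c) ≠ 0 → ∃ φ r, c = T.good φ false r) :
    outputProb (T.stage₂ e) (T.outW e) ψ =
      ∑ r, outputProb T.dist T.out (slice e ψ (T.good true false r)) := by
  classical
  -- The final Toffoli gate is pulled back to the extra qubits, leaving the distinguisher on a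
  -- single slice.
  have hstage : ∀ p c, Circuit.apply (T.stage₂ e) ψ (joinBits e p c) =
      Circuit.apply T.dist (slice e ψ (Function.update c (.inr (.inr (.inr (.inr true))))
        (xor (c (.inr (.inr (.inr (.inr true)))))
          (c (.inr (.inr (.inr (.inr false)))) && p T.out)))) p := by
    intro p c
    rw [stage₂, Circuit.apply_append, ← slice_apply_mapWires, Circuit.apply_cons]
    change _ = Circuit.apply (Circuit.mapWires (mainEmb e) T.dist) ψ (joinBits e p _)
    rw [← update_joinBits_inr]
    simp [Circuit.apply, Gate.apply, outW, flagW]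
  have hzero : ∀ c, (¬ ∃ φ r, c = T.good φ false r) → Circuit.apply T.dist (slice e ψ c) = 0 := by
    intro c hc
    have : slice e ψ c = 0 := by
      ext p
      by_contra h
      exact hc (hψ p c h)
    rw [this, Circuit.apply_zero]
  rw [outputProb, normSq_eq_sum_slice e]
  symm
  -- Among all values of the extra qubits only those with flag and output both 1 contribute, one for
  -- each `r`.
  refine Fintype.sum_of_injective (T.good true true) (fun r r' h => (T.good_inj h).1) _ _ ?_ ?_
  · intro c hc
    have : slice e (project {b | b (T.outW e) = true} (Circuit.apply (T.stage₂ e) ψ)) c = 0 := by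
      ext p
      by_contra h
      have hmem : joinBits e p c ∈ {b | b (T.outW e) = true} := by
        by_contra hm
        exact h (Set.indicator_of_notMem hm _)
      rw [slice, project, Set.indicator_of_mem hmem, hstage] at h
      have ho : c (.inr (.inr (.inr (.inr true)))) = true := by
        simpa [outW] using hmem
      obtain ⟨φ, r, hr⟩ : ∃ φ r, Function.update c (.inr (.inr (.inr (.inr true))))
        (xor (c (.inr (.inr (.inr (.inr true)))))
          (c (.inr (.inr (.inr (.inr false)))) && p T.out)) = T.good φ false r := by
        by_contra hne
        exact h (congrFun (hzero _ hne) p)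
      have h1 := congrFun hr (.inr (.inr (.inr (.inr true))))
      rw [Function.update_self, ho] at h1
      simp only [good, Sum.elim_inr, cond_true] at h1
      have h2 : c (.inr (.inr (.inr (.inr false)))) = true := by
        revert h1
        cases c (.inr (.inr (.inr (.inr false)))) <;> simp
      refine hc ⟨r, ?_⟩
      ext x
      by_cases hx : x = .inr (.inr (.inr (.inr true)))
      · subst hx
        exact ho.symm
      by_cases hx' : x = .inr (.inr (.inr (.inr false)))
      · subst hx'
        exact h2.symm
      · have := congrFun hr x
        rw [Function.update_of_ne hx] at this
        rw [this]
        rcases x with x | x | x | x | _ | _ <;> first | exact absurd rfl hx | exact absurd rfl hx' | rfl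
    rw [this]
    simp [normSq]
  · intro r
    rw [outputProb]
    congr 1
    ext p
    have hmem : joinBits e p (T.good true true r) ∈ {b | b (T.outW e) = true} := by
      simp [outW, good]
    rw [slice, project, project, Set.indicator_of_mem hmem, hstage]
    have hupd : Function.update (T.good true true r) (.inr (.inr (.inr (.inr true))))
        (xor (T.good true true r (.inr (.inr (.inr (.inr true)))))
          (T.good true true r (.inr (.inr (.inr (.inr false)))) && p T.out)) =
        T.good true (!(p T.out)) r := by
      ext x
      rcases x with x | x | x | x | _ | _ <;> simp [good]
    rw [hupd]
    by_cases hp : p T.out = true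
    · rw [Set.indicator_of_mem (show p ∈ {b | b T.out = true} from hp), hp]
      rfl
    · rw [Set.indicator_of_notMem (show p ∉ {b | b T.out = true} from hp), hzero]
      · rfl
      · rintro ⟨φ, r', h⟩
        have := (T.good_inj h).2.2
        simp at this
        exact hp this

theorem challengeProb_stage₂ {n : ℕ} (b : Bool) (reg : Fin n → B) (ψ : QState W)
    (hψ : ∀ p c, ψ (joinBits e p c) ≠ 0 → ∃ φ r, c = T.good φ false r) :
    challengeProb b (fun j => e (.inl (reg j))) (T.stage₂ e) (T.outW e) ψ =
      ∑ r, challengeProb b reg T.dist T.out (slice e ψ (T.good true false r)) := by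
  cases b
  · exact T.outputProb_stage₂ e ψ hψ
  · simp only [challengeProb, if_true]
    rw [Finset.sum_comm]
    refine Finset.sum_congr rfl fun s _ => ?_
    rw [T.outputProb_stage₂ e]
    · refine Finset.sum_congr rfl fun r _ => ?_
      congr 1
      ext p
      simp [slice, project, Set.indicator, regEq]
      congr
    · intro p c h
      exact hψ p c (Set.indicator_apply_ne_zero.1 h).2

end

end CoinReduction

/-! ### Two-round provers -/

namespace QProver

variable {k z : Fin 2 → ℕ} (P : QProver k z)

/-- The two messages of the verifier. -/
def pairMsg (c : BitStr (k 0)) (r : BitStr (k 1)) : ∀ i, BitStr (k i)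
  | 0 => c
  | 1 => r

/-- The qubits of the experiment that are neither the first challenge register nor one of the two
response registers, together with the private qubits of a `CoinReduction`. -/
abbrev WorkSpace (anc s₁ s₂ : ℕ) : Type :=
  Fin P.work ⊕ (Fin (k 1) ⊕ (Fin anc ⊕ (Fin (k 1) ⊕ (Fin s₁ ⊕ (Fin s₂ ⊕ Bool)))))

/-- The qubits of the experiment and those of a `CoinReduction`, arranged as work space, first
challenge register, first response register, query string and second response register. -/
def arrange (anc nq s₁ s₂ : ℕ) :
    P.Wire anc ⊕ (Fin (k 1) ⊕ (Fin nq ⊕ (Fin s₁ ⊕ (Fin s₂ ⊕ Bool)))) ≃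
      P.WorkSpace anc s₁ s₂ ⊕ (Fin (k 0) ⊕ ((Fin (z 0) ⊕ Fin nq) ⊕ Fin (z 1))) where
  toFun
    | .inl (.inl w) => .inl (.inl w)
    | .inl (.inr (.inl ⟨0, j⟩)) => .inr (.inl j)
    | .inl (.inr (.inl ⟨1, j⟩)) => .inl (.inr (.inl j))
    | .inl (.inr (.inr (.inl ⟨0, j⟩))) => .inr (.inr (.inl (.inl j)))
    | .inl (.inr (.inr (.inl ⟨1, j⟩))) => .inr (.inr (.inr j))
    | .inl (.inr (.inr (.inr a))) => .inl (.inr (.inr (.inl a)))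
    | .inr (.inl j) => .inl (.inr (.inr (.inr (.inl j))))
    | .inr (.inr (.inl j)) => .inr (.inr (.inl (.inr j)))
    | .inr (.inr (.inr y)) => .inl (.inr (.inr (.inr (.inr y))))
  invFun
    | .inl (.inl w) => .inl (.inl w)
    | .inr (.inl j) => .inl (.inr (.inl ⟨0, j⟩))
    | .inl (.inr (.inl j)) => .inl (.inr (.inl ⟨1, j⟩))
    | .inr (.inr (.inl (.inl j))) => .inl (.inr (.inr (.inl ⟨0, j⟩)))
    | .inr (.inr (.inr j)) => .inl (.inr (.inr (.inl ⟨1, j⟩)))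
    | .inl (.inr (.inr (.inl a))) => .inl (.inr (.inr (.inr a)))
    | .inl (.inr (.inr (.inr (.inl j)))) => .inr (.inl j)
    | .inr (.inr (.inl (.inr j))) => .inr (.inr (.inl j))
    | .inl (.inr (.inr (.inr (.inr y)))) => .inr (.inr (.inr y))
  left_inv := by
    rintro ((w | ⟨i, j⟩ | ⟨i, j⟩ | a) | j | j | y)
    · rfl
    · fin_cases i <;> rfl
    · fin_cases i <;> rfl
    all_goals rfl
  right_inv := by
    rintro ((w | j | a | j | y) | j | (j | j) | j) <;> rfl

/-- `arrange` with numbered work qubits. -/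
noncomputable def wireEquiv (anc nq s₁ s₂ : ℕ) :
    P.Wire anc ⊕ (Fin (k 1) ⊕ (Fin nq ⊕ (Fin s₁ ⊕ (Fin s₂ ⊕ Bool)))) ≃
      Fin (Fintype.card (P.WorkSpace anc s₁ s₂)) ⊕
        (Fin (k 0) ⊕ ((Fin (z 0) ⊕ Fin nq) ⊕ Fin (z 1))) :=
  (P.arrange anc nq s₁ s₂).trans (Equiv.sumCongr (Fintype.equivFin _) (Equiv.refl _))

/-- Writing the coins into the empty second challenge register yields the start state of the real
interaction, where that message is present from the beginning. -/
theorem extend_initial (anc : ℕ) (c : BitStr (k 0)) (r : BitStr (k 1)) :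
    Function.extend (fun j : Fin (k 1) => (.inr (.inl ⟨1, j⟩) : P.Wire anc)) r
      (P.initial anc (pairMsg c fun _ => false)) = P.initial anc (pairMsg c r) := by
  have hinj : Function.Injective (fun j : Fin (k 1) => (.inr (.inl ⟨1, j⟩) : P.Wire anc)) :=
    fun i j h => by simpa using h
  ext w
  rcases w with w | ⟨i, j⟩ | w | w
  · rw [Function.extend_apply' _ _ _ (by simp)]
    rfl
  · fin_cases i
    · rw [Function.extend_apply' _ _ _ (by simp)]
      rfl
    · exact hinj.extend_apply _ _ j
  · rw [Function.extend_apply' _ _ _ (by simp)]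
    rfl
  · rw [Function.extend_apply' _ _ _ (by simp)]
    rfl

/-- Postpones the measurement of the commitment until after the second round, where the vector
commitment experiment performs it. -/
theorem step_one_project (anc : ℕ) (s : BitStr (z 0)) (ψ : QState (P.Wire anc)) :
    P.step anc 1 (project (regEq (P.respReg anc 0) s) ψ) =
      project (regEq (P.respReg anc 0) s) (P.step anc 1 ψ) := by
  refine apply_mapWires_project_regEq _ _ _ (fun v j => ?_) s ψ
  rcases v with v | v | v <;> simp [roundEmb, respReg, Function.Embedding.sumMap]

end QProver

/-! ### Encodings -/

/-- With at most `t` locations, every symbol has its own slot and none is truncated. -/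
theorem encodeAnswers_injective {A : Alphabet} {ℓ t : ℕ} {Q : Finset (Fin ℓ)} (hQ : Q.card ≤ t) :
    Function.Injective (encodeAnswers (A := A) t Q) := by
  intro v v' h
  ext i
  obtain ⟨n, rfl⟩ := (Q.orderIsoOfFin rfl).surjective i
  rename_i l
  have h := congrFun h (finProdFinEquiv (⟨n, n.2.trans_le hQ⟩, l))
  simp only [encodeAnswers, Equiv.symm_apply_apply, Fin.is_lt, dif_pos] at h
  exact h

/-! ### The reduction -/

section Kilian

variable {S : PCP} {VC : VectorCommitment} {lam : ℕ} {x : List Bool}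

/-- The qubits of a prover in Kilian's protocol, as a `CoinReduction`. -/
noncomputable def kilianReduction (P : QProver ((kilian S VC).chalLen lam x) ((kilian S VC).respLen lam x))
    (D : Distinguisher P)
    (CQ : BoolCircuit (S.randLen lam x.length)
      (S.queryLen lam x.length * indexLen (S.proofLen lam x.length)))
    (CD : BoolCircuit (S.randLen lam x.length +
        S.queryLen lam x.length * (S.alphabet lam x.length).width) 1) :
    CoinReduction (P.Wire D.anc) where
  m := S.randLen lam x.length
  nq := S.queryLen lam x.length * indexLen (S.proofLen lam x.length)
  a := S.queryLen lam x.length * (S.alphabet lam x.length).width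
  queryCirc := CQ
  decideCirc := CD
  chalReg j := .inr (.inl ⟨(1 : Fin 2), j⟩)
  chalReg_inj := fun _ _ h => eq_of_heq (Sigma.mk.inj (Sum.inl.inj (Sum.inr.inj h))).2
  ansReg j := P.respReg D.anc (1 : Fin 2) (Fin.castAdd (VC.maxProofLen lam _ _ _) j)
  ansReg_inj := fun _ _ h => Fin.castAdd_injective _ _
    (eq_of_heq (Sigma.mk.inj (Sum.inl.inj (Sum.inr.inj (Sum.inr.inj h)))).2)
  -- Both rounds form one circuit: the coins are prepared beforehand, and the first round cannot
  -- access the second challenge register.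
  prover := Circuit.mapWires (P.roundEmb D.anc (0 : Fin 2)) (P.U (0 : Fin 2)) ++
    Circuit.mapWires (P.roundEmb D.anc (1 : Fin 2)) (P.U (1 : Fin 2))
  dist := D.circuit
  out := D.out

variable (P : QProver ((kilian S VC).chalLen lam x) ((kilian S VC).respLen lam x))
    (D : Distinguisher P)
    (CQ : BoolCircuit (S.randLen lam x.length)
      (S.queryLen lam x.length * indexLen (S.proofLen lam x.length)))
    (CD : BoolCircuit (S.randLen lam x.length +
        S.queryLen lam x.length * (S.alphabet lam x.length).width) 1)

/-- The arrangement of the qubits as those of an adversary against the vector commitment. -/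
noncomputable def kilianEquiv : P.Wire D.anc ⊕ (kilianReduction P D CQ CD).Extra ≃
    VC.AdvWire lam (S.alphabet lam x.length) (S.proofLen lam x.length)
      (Fintype.card (QProver.WorkSpace (k := (kilian S VC).chalLen lam x) P D.anc
        CQ.gates.length CD.gates.length)) (S.queryLen lam x.length) :=
  QProver.wireEquiv (k := (kilian S VC).chalLen lam x) P D.anc _ CQ.gates.length CD.gates.length

/-- The adversary against the vector commitment: it samples the second message of the verifier
itself, and checks the decision of the PCP verifier. -/
noncomputable def kilianAdversary :
    VC.Adversary lam (S.alphabet lam x.length) (S.proofLen lam x.length) where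
  work := Fintype.card (QProver.WorkSpace (k := (kilian S VC).chalLen lam x) P D.anc
    CQ.gates.length CD.gates.length)
  t := S.queryLen lam x.length
  stage₁ := (kilianReduction P D CQ CD).stage₁ (kilianEquiv P D CQ CD)
  stage₂ := (kilianReduction P D CQ CD).stage₂ (kilianEquiv P D CQ CD)
  out := (kilianReduction P D CQ CD).outW (kilianEquiv P D CQ CD)

theorem kilianAdversary_initial (ck : BitStr (kilianKeyLen S VC lam x)) :
    (kilianAdversary P D CQ CD).initial ck = joinBits (kilianEquiv P D CQ CD)
      (P.initial D.anc (QProver.pairMsg (k := (kilian S VC).chalLen lam x) ck fun _ => false))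
      fun _ => false := by
  refine bits_ext (kilianEquiv P D CQ CD) (fun w => ?_) (fun w => ?_)
  · rw [joinBits_inl]
    rcases w with w | ⟨i, j⟩ | ⟨i, j⟩ | w
    · rfl
    · change Fin 2 at i
      fin_cases i <;> rfl
    · change Fin 2 at i
      fin_cases i <;> rfl
    · rfl
  · rw [joinBits_inr]
    rcases w with w | w | w <;> rfl

/-- The state before the decision of the verifier, if the messages are `ck`, `cm` and `r`. -/
noncomputable def kilianState (ck : BitStr (kilianKeyLen S VC lam x))
    (cm : BitStr (kilianComLen S VC lam x)) (r : BitStr (S.randLen lam x.length)) :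
    QState (P.Wire D.anc) :=
  project {b | kilianAccepts S VC lam x ck cm r fun j => b (P.respReg D.anc (1 : Fin 2) j)}
    (P.step D.anc (1 : Fin 2) (project (regEq (P.respReg D.anc (0 : Fin 2)) cm)
      (P.step D.anc (0 : Fin 2)
        (ket (P.initial D.anc (QProver.pairMsg (k := (kilian S VC).chalLen lam x) ck r))))))

/-- `CQ` and `CD` compute the queries and the decision of the verifier of `S` on the instance `x`. -/
structure ComputeVerifier : Prop where
  query : ∀ r, decodeSet _ _ (CQ.eval r) = S.query lam x r
  decide : ∀ r a, CD.eval (Fin.append r a) 0 = true ↔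
    ∃ v, a = encodeAnswers (S.queryLen lam x.length) (S.query lam x r) v ∧
      S.decide lam x r v = true

variable {CQ CD}

/-- The decision circuit and the opening check each provide a string of answers with the same
encoding in the first part of `y`; by injectivity they coincide. -/
theorem ComputeVerifier.accepts_iff (h : ComputeVerifier (S := S) CQ CD)
    (ck : BitStr (kilianKeyLen S VC lam x)) (cm : BitStr (kilianComLen S VC lam x))
    (r : BitStr (S.randLen lam x.length)) (y : BitStr (kilianOpenLen S VC lam x)) :
    kilianAccepts S VC lam x ck cm r y ↔
      CD.eval (Fin.append r fun j => y (Fin.castAdd _ j)) 0 = true ∧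
      ∃ v pf, y = VC.encodeOpening lam _ _ _ (decodeSet _ _ (CQ.eval r)) v pf ∧
        VC.verify lam _ _ ck cm (decodeSet _ _ (CQ.eval r)) v pf = true := by
  rw [h.query, h.decide]
  constructor
  · rintro ⟨v, pf, rfl, hd, hv⟩
    exact ⟨⟨v, by ext j; simp [VectorCommitment.encodeOpening], hd⟩, v, pf, rfl, hv⟩
  · rintro ⟨⟨v', hv', hd⟩, v, pf, rfl, hv⟩
    obtain rfl : v = v' := encodeAnswers_injective (S.card_query_le lam x r) (by
      rw [← hv']
      ext j
      simp [VectorCommitment.encodeOpening])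
    exact ⟨v, pf, rfl, hd, hv⟩

theorem slice_stage₁_kilianAdversary (ck : BitStr (kilianKeyLen S VC lam x))
    (r : BitStr (S.randLen lam x.length)) :
    slice (kilianEquiv P D CQ CD) (Circuit.apply (kilianAdversary P D CQ CD).stage₁
        (ket ((kilianAdversary P D CQ CD).initial ck)))
      ((kilianReduction P D CQ CD).good true false r) =
    ((1 / (Real.sqrt 2 : ℂ)) ^ S.randLen lam x.length) •
      project {p | CD.eval (Fin.append r fun j =>
          p (P.respReg D.anc (1 : Fin 2) (Fin.castAdd _ j))) 0 = true}
        (P.step D.anc (1 : Fin 2) (P.step D.anc (0 : Fin 2)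
          (ket (P.initial D.anc (QProver.pairMsg (k := (kilian S VC).chalLen lam x) ck r))))) := by
  rw [kilianAdversary_initial]
  refine ((kilianReduction P D CQ CD).slice_apply_stage₁ (kilianEquiv P D CQ CD) _
    (fun j => rfl) r).trans ?_
  have hext := QProver.extend_initial (k := (kilian S VC).chalLen lam x) P D.anc ck r
  refine congrArg (fun φ => ((1 / (Real.sqrt 2 : ℂ)) ^ S.randLen lam x.length) • project _ φ) ?_
  refine (Circuit.apply_append _ _ _).trans ?_
  refine congrArg (fun b => P.step D.anc (1 : Fin 2) (P.step D.anc (0 : Fin 2) (ket b))) ?_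
  exact hext

/-- Pointwise comparison of amplitudes for the next theorem, where `c` says that the measured query
string is the one of the current coins. Only then does the opening check refer to the right query
set, so `hkil` is conditional. -/
theorem project_project_eq {V W : Type} {acc U : Set (W → Bool)} {dec com kil : Set (V → Bool)}
    {ψ : QState W} {φ : QState V} {b : W → Bool} {p : V → Bool} {a : ℂ} {c : Prop} [Decidable c]
    (hU : b ∈ U ↔ p ∈ com ∧ c) (hkil : c → (p ∈ kil ↔ p ∈ dec ∧ b ∈ acc))
    (hψ : ψ b = (a • project dec φ) p) :
    project acc (project U ψ) b = (if c then a else 0) • project kil (project com φ) p := by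
  classical
  by_cases hc : c
  · simp only [project, Set.indicator_apply, hU, hkil hc, hψ, hc, Pi.smul_apply, smul_eq_mul]
    split_ifs <;> first | rfl | (exfalso; tauto) | simp
  · simp [project, Set.indicator_apply, hU, hc]

/-- In a coin branch with positive flag, passing the opening check completes the acceptance test of
Kilian's verifier. The query register already holds a definite string in this branch, so measuring
it either does nothing or annihilates the branch. -/
theorem slice_kilianAdversary (h : ComputeVerifier (S := S) CQ CD)
    (ck : BitStr (kilianKeyLen S VC lam x)) (cm : BitStr (kilianComLen S VC lam x))
    (r : BitStr (S.randLen lam x.length))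
    (q : BitStr (S.queryLen lam x.length * indexLen (S.proofLen lam x.length))) :
    slice (kilianEquiv P D CQ CD)
      (project ((kilianAdversary P D CQ CD).acceptSet ck cm (decodeSet _ _ q))
        (project (regEq (kilianAdversary P D CQ CD).comReg cm ∩
            regEq (kilianAdversary P D CQ CD).setReg q)
          (Circuit.apply (kilianAdversary P D CQ CD).stage₁
            (ket ((kilianAdversary P D CQ CD).initial ck)))))
      ((kilianReduction P D CQ CD).good true false r) =
    (if q = CQ.eval r then (1 / (Real.sqrt 2 : ℂ)) ^ S.randLen lam x.length else 0) •
      kilianState P D ck cm r := by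
  classical
  ext p
  set b := joinBits (kilianEquiv P D CQ CD) p ((kilianReduction P D CQ CD).good true false r)
    with hb
  have hopen : ∀ j, b ((kilianAdversary P D CQ CD).openReg j) =
      p (P.respReg D.anc (1 : Fin 2) j) := fun j =>
    joinBits_inl (kilianEquiv P D CQ CD) p _ (P.respReg D.anc (1 : Fin 2) j)
  have hcom : b ∈ regEq (kilianAdversary P D CQ CD).comReg cm ↔
      p ∈ regEq (P.respReg D.anc (0 : Fin 2)) cm := by
    refine forall_congr' fun j => ?_
    have : b ((kilianAdversary P D CQ CD).comReg j) = p (P.respReg D.anc (0 : Fin 2) j) :=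
      joinBits_inl (kilianEquiv P D CQ CD) p _ (P.respReg D.anc (0 : Fin 2) j)
    rw [this]
  have hset : b ∈ regEq (kilianAdversary P D CQ CD).setReg q ↔ q = CQ.eval r := by
    rw [eq_comm, funext_iff]
    refine forall_congr' fun j => ?_
    have : b ((kilianAdversary P D CQ CD).setReg j) = CQ.eval r j :=
      joinBits_inr (kilianEquiv P D CQ CD) _ _ (.inr (.inl j))
    rw [this]
  have hst := congrFun (slice_stage₁_kilianAdversary P D (CQ := CQ) (CD := CD) ck r) p
  have hcomm := QProver.step_one_project (k := (kilian S VC).chalLen lam x) P D.anc cm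
    (P.step D.anc (0 : Fin 2)
        (ket (P.initial D.anc (QProver.pairMsg (k := (kilian S VC).chalLen lam x) ck r))))
  rw [Pi.smul_apply, kilianState]
  refine Eq.trans ?_ (congrArg (fun φ => _ • project _ φ p) hcomm.symm)
  refine project_project_eq (and_congr hcom hset) (fun hq => ?_) hst
  subst hq
  refine (h.accepts_iff ck cm r _).trans (and_congr Iff.rfl ⟨?_, ?_⟩)
  · rintro ⟨v, pf, h₁, h₂⟩
    exact ⟨v, pf, (funext hopen).trans h₁, h₂⟩
  · rintro ⟨v, pf, h₁, h₂⟩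
    exact ⟨v, pf, (funext hopen).symm.trans h₁, h₂⟩

/-- Each `r` survives for exactly one outcome `q`, so summing over `q` leaves one term per `r`, even
when several `r` share the same `q`. -/
theorem challengeProb_kilianAdversary (h : ComputeVerifier (S := S) CQ CD) (b : Bool)
    (ck : BitStr (kilianKeyLen S VC lam x)) (cm : BitStr (kilianComLen S VC lam x)) :
    ∑ q, challengeProb b (kilianAdversary P D CQ CD).openReg (kilianAdversary P D CQ CD).stage₂
      (kilianAdversary P D CQ CD).out
      (project ((kilianAdversary P D CQ CD).acceptSet ck cm (decodeSet _ _ q))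
        (project (regEq (kilianAdversary P D CQ CD).comReg cm ∩
            regEq (kilianAdversary P D CQ CD).setReg q)
          (Circuit.apply (kilianAdversary P D CQ CD).stage₁
            (ket ((kilianAdversary P D CQ CD).initial ck))))) =
    ∑ r, (1 / 2) ^ S.randLen lam x.length *
      challengeProb b (P.respReg D.anc (1 : Fin 2)) D.circuit D.out (kilianState P D ck cm r) := by
  classical
  have key : ∀ q : BitStr (S.queryLen lam x.length * indexLen (S.proofLen lam x.length)),
      challengeProb b (kilianAdversary P D CQ CD).openReg
      (kilianAdversary P D CQ CD).stage₂ (kilianAdversary P D CQ CD).out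
      (project ((kilianAdversary P D CQ CD).acceptSet ck cm (decodeSet _ _ q))
        (project (regEq (kilianAdversary P D CQ CD).comReg cm ∩
            regEq (kilianAdversary P D CQ CD).setReg q)
          (Circuit.apply (kilianAdversary P D CQ CD).stage₁
            (ket ((kilianAdversary P D CQ CD).initial ck))))) =
      ∑ r, if q = CQ.eval r then (1 / 2) ^ S.randLen lam x.length *
        challengeProb b (P.respReg D.anc (1 : Fin 2)) D.circuit D.out (kilianState P D ck cm r)
        else 0 := by
    intro q
    refine ((kilianReduction P D CQ CD).challengeProb_stage₂ (kilianEquiv P D CQ CD) b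
      (P.respReg D.anc (1 : Fin 2)) _ (fun p c hne => ?_)).trans ?_
    · have hne : Circuit.apply (kilianAdversary P D CQ CD).stage₁
          (ket ((kilianAdversary P D CQ CD).initial ck)) (joinBits (kilianEquiv P D CQ CD) p c) ≠ 0 :=
        (Set.indicator_apply_ne_zero.1 (Set.indicator_apply_ne_zero.1 hne).2).2
      rw [kilianAdversary_initial] at hne
      exact (kilianReduction P D CQ CD).apply_stage₁_support (kilianEquiv P D CQ CD) _
        (fun j => rfl) p c hne
    · refine Finset.sum_congr rfl fun r _ => ?_
      refine (congrArg (challengeProb b (P.respReg D.anc (1 : Fin 2)) D.circuit D.out)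
        (slice_kilianAdversary P D h ck cm r q)).trans ?_
      refine (challengeProb_smul _ _ _ _ _ _).trans ?_
      by_cases hq : q = CQ.eval r
      · rw [if_pos hq, if_pos hq]
        congr 1
        -- The squared modulus of `(1/√2)^m` is `(1/2)^m`, the probability of one coin string.
        rw [norm_pow, ← pow_mul, mul_comm, pow_mul]
        simp
      · rw [if_neg hq, if_neg hq]
        simp
  refine (Finset.sum_congr rfl fun q _ => key q).trans (Finset.sum_comm.trans ?_)
  refine Finset.sum_congr rfl fun r _ => ?_
  exact (Finset.sum_eq_single (CQ.eval r) (fun q _ hq => if_neg hq)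
    (fun h => absurd (Finset.mem_univ _) h)).trans (if_pos rfl)

theorem expProb_kilianAdversary (h : ComputeVerifier (S := S) CQ CD) (b : Bool) :
    (kilianAdversary P D CQ CD).expProb b = (kilian S VC).collapseProb lam x b P D := by
  have hcol : (kilian S VC).collapseProb lam x b P D =
      ∑ ck : BitStr (kilianKeyLen S VC lam x), ∑ r : BitStr (S.randLen lam x.length),
        ((VC.gen lam (S.alphabet lam x.length) (S.proofLen lam x.length) ck).toReal *
          (1 / 2) ^ S.randLen lam x.length) * ∑ cm : BitStr (kilianComLen S VC lam x),
          challengeProb b (P.respReg D.anc (1 : Fin 2)) D.circuit D.out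
            (kilianState P D ck cm r) := by
    rw [← Fintype.sum_prod_type', Protocol.collapseProb]
    refine Fintype.sum_equiv (show (∀ i, BitStr ((kilian S VC).chalLen lam x i)) ≃
        -- The tuple of the two verifier messages is split into the key and the coins, whose
        -- probabilities multiply.
        BitStr (kilianKeyLen S VC lam x) × BitStr (S.randLen lam x.length) from
      piFinTwoEquiv fun i : Fin 2 => BitStr ((kilian S VC).chalLen lam x i)) _ _ fun R => ?_
    have hR : QProver.pairMsg (k := (kilian S VC).chalLen lam x) (R (0 : Fin 2)) (R (1 : Fin 2))
        = R := by
      ext i j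
      change Fin 2 at i
      fin_cases i <;> rfl
    congr 1
    · refine (Fin.prod_univ_two _).trans ?_
      have hunif : ∀ y : BitStr (S.randLen lam x.length),
          (PMF.uniformOfFintype (BitStr (S.randLen lam x.length)) y).toReal =
            (1 / 2) ^ S.randLen lam x.length := by
        simp [PMF.uniformOfFintype_apply]
      exact congrArg (_ * ·) (hunif _)
    · refine Fintype.sum_equiv (show (∀ i : Fin (kilian S VC).last,
          BitStr ((kilian S VC).respLen lam x i.castSucc)) ≃ BitStr (kilianComLen S VC lam x) from
        Equiv.piUnique fun i : Fin 1 =>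
          BitStr ((kilian S VC).respLen lam x (Fin.castSucc i))) _ _ fun s => ?_
      congr 1
      change _ = project _ (P.step D.anc (1 : Fin 2) (project _ (P.step D.anc (0 : Fin 2)
        (ket (P.initial D.anc (QProver.pairMsg (k := (kilian S VC).chalLen lam x)
          (R (0 : Fin 2)) (R (1 : Fin 2))))))))
      rw [hR]
      rfl
  rw [hcol, VectorCommitment.Adversary.expProb]
  refine Finset.sum_congr rfl fun ck _ => ?_
  refine (congrArg (_ * ·) (Finset.sum_congr rfl fun cm _ =>
    challengeProb_kilianAdversary P D h b ck cm)).trans ?_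
  rw [Finset.sum_comm, Finset.mul_sum]
  refine Finset.sum_congr rfl fun r _ => ?_
  rw [← Finset.mul_sum, mul_assoc]

/-- The factor 12 is generous. The qubits count once for each stage, and with `S.randLen lam
x.length ≤ CQ.size` the total is at most `P.size + 2 * D.size + 8 * CQ.size + 6 * CD.size + 5`. -/
theorem size_kilianAdversary : (kilianAdversary P D CQ CD).size ≤
    12 * (P.size + D.size + CQ.size + CD.size + 1) := by
  have h₁ := (kilianReduction P D CQ CD).length_stage₁ (kilianEquiv P D CQ CD)
  have h₂ := (kilianReduction P D CQ CD).length_stage₂ (kilianEquiv P D CQ CD)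
  have hcard : Fintype.card (kilianAdversary P D CQ CD).Wire =
      Fintype.card (P.Wire D.anc) + Fintype.card (kilianReduction P D CQ CD).Extra := by
    rw [← Fintype.card_sum]
    exact (Fintype.card_congr (kilianEquiv P D CQ CD)).symm
  have hextra : Fintype.card (kilianReduction P D CQ CD).Extra =
      S.randLen lam x.length + (S.queryLen lam x.length * indexLen (S.proofLen lam x.length) +
        (CQ.gates.length + (CD.gates.length + 2))) := by
    change Fintype.card (Fin (S.randLen lam x.length) ⊕
      (Fin (S.queryLen lam x.length * indexLen (S.proofLen lam x.length)) ⊕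
        (Fin CQ.gates.length ⊕ (Fin CD.gates.length ⊕ Bool)))) = _
    simp
  have hprover : (kilianReduction P D CQ CD).prover.length ≤ P.size := by
    have hP : P.size = Circuit.size (P.U (0 : Fin 2)) + Circuit.size (P.U (1 : Fin 2)) :=
      Fin.sum_univ_two _
    rw [hP]
    refine le_of_eq_of_le ?_ (add_le_add (Nat.le_add_right (P.U (0 : Fin 2)).length _)
      (Nat.le_add_right (P.U (1 : Fin 2)).length _))
    simp [kilianReduction, Circuit.mapWires]
  have hsize : (kilianAdversary P D CQ CD).size =
      (kilianAdversary P D CQ CD).stage₁.length + Fintype.card (kilianAdversary P D CQ CD).Wire +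
        ((kilianAdversary P D CQ CD).stage₂.length +
          Fintype.card (kilianAdversary P D CQ CD).Wire) := rfl
  have hD : D.size = D.circuit.length + Fintype.card (P.Wire D.anc) := rfl
  have hCQ : CQ.size = S.randLen lam x.length + CQ.gates.length +
    S.queryLen lam x.length * indexLen (S.proofLen lam x.length) := rfl
  have hCD : CD.size = S.randLen lam x.length + S.queryLen lam x.length *
    (S.alphabet lam x.length).width + CD.gates.length + 1 := rfl
  change (kilianAdversary P D CQ CD).stage₁.length ≤
    2 * S.randLen lam x.length + 4 * CQ.size + _ + 4 * CD.size at h₁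
  change (kilianAdversary P D CQ CD).stage₂.length = D.circuit.length + 1 at h₂
  omega

end Kilian

/-! ### Polynomial bounds -/

theorem PolyBounded.mono {f g : ℕ → ℕ} (hg : PolyBounded g) (h : ∀ lam, f lam ≤ g lam) :
    PolyBounded f := by
  obtain ⟨p, l, hp⟩ := hg
  exact ⟨p, l, fun lam hl => (h lam).trans (hp lam hl)⟩

theorem PolyBounded.add {f g : ℕ → ℕ} (hf : PolyBounded f) (hg : PolyBounded g) :
    PolyBounded fun lam => f lam + g lam := by
  obtain ⟨p, l, hp⟩ := hf
  obtain ⟨q, l', hq⟩ := hg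
  refine ⟨p + q, max l l', fun lam hl => ?_⟩
  rw [Polynomial.eval_add]
  exact add_le_add (hp _ ((le_max_left _ _).trans_lt hl)) (hq _ ((le_max_right _ _).trans_lt hl))

theorem PolyBounded.const_mul {f : ℕ → ℕ} (hf : PolyBounded f) (c : ℕ) :
    PolyBounded fun lam => c * f lam := by
  obtain ⟨p, l, hp⟩ := hf
  refine ⟨Polynomial.C c * p, l, fun lam hl => ?_⟩
  rw [Polynomial.eval_mul, Polynomial.eval_C]
  exact Nat.mul_le_mul_left _ (hp _ hl)

theorem polyBounded_const (c : ℕ) : PolyBounded fun _ => c :=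
  ⟨Polynomial.C c, 0, fun _ _ => by simp⟩

theorem polyBounded_id : PolyBounded fun lam => lam :=
  ⟨Polynomial.X, 0, fun _ _ => by simp⟩

/-- Coefficients in `ℕ` are nonnegative; monotonicity is what lets polynomial bounds compose. -/
theorem eval_mono (p : Polynomial ℕ) : Monotone fun n : ℕ => p.eval n := by
  intro a b hab
  simp only [Polynomial.eval_eq_sum, Polynomial.sum]
  exact Finset.sum_le_sum fun i _ => Nat.mul_le_mul_left _ (Nat.pow_le_pow_left hab i)

theorem PolyBounded.eval {f : ℕ → ℕ} (hf : PolyBounded f) (p : Polynomial ℕ) :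
    PolyBounded fun lam => p.eval (f lam) := by
  obtain ⟨q, l, hq⟩ := hf
  refine ⟨p.comp q, l, fun lam hl => ?_⟩
  rw [Polynomial.eval_comp]
  exact eval_mono p (hq lam hl)

end PQ

/-! ### The asymptotic conclusion. -/

theorem claim6p3 (VC : PQ.VectorCommitment) (hVC : VC.IsCollapsing)
    (R : Set (List Bool × List Bool)) (ε : ℕ → ℕ → ℝ) (S : PQ.PCP) (hS : S.IsPCPFor R ε) :
    (PQ.kilian S VC).IsCollapsing := by
  intro x hx P D hP hD
  obtain ⟨p, hp⟩ := hS.efficient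
  -- One pair of verifier circuits is fixed for each `lam` and its instance; the adversary is
  -- non-uniform, so it may have them built in.
  choose CQ hQsize hQ using fun lam => (hp lam (x lam)).1
  choose CD hDsize hDec using fun lam => (hp lam (x lam)).2
  have hbound : PQ.PolyBounded fun lam => p.eval (lam + (x lam).length) :=
    (PQ.polyBounded_id.add hx).eval p
  have hneg := hVC (fun lam => S.alphabet lam (x lam).length)
    (fun lam => S.proofLen lam (x lam).length)
    (fun lam => PQ.kilianAdversary (P lam) (D lam) (CQ lam) (CD lam))
    (((((((hP.add hD).add hbound).add hbound).add (PQ.polyBounded_const 1)).const_mul 12).mono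
      fun lam => (PQ.size_kilianAdversary (P lam) (D lam)).trans (Nat.mul_le_mul_left _ (by
        have h₁ := hQsize lam
        have h₂ := hDsize lam
        omega))))
  -- Equality holds for every `lam` and both values of `b`, so the two distinguishing advantages are
  -- the same function.
  have heq : ∀ lam b, (PQ.kilianAdversary (P lam) (D lam) (CQ lam) (CD lam)).expProb b =
      (PQ.kilian S VC).collapseProb lam (x lam) b (P lam) (D lam) := fun lam b =>
    PQ.expProb_kilianAdversary (P lam) (D lam) ⟨hQ lam, hDec lam⟩ b
  simpa only [heq] using hneg
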